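/- Let $R$ be a commutative ring, $M$ a finitely generated $R$-module and ${\bf x}=x_1,\dots,x_\ell$ a finite sequence of elements of $R$, with $\ell({\bf x})=\ell\ge 0$ its length. For $m\ge n$ put ${\bf x}^m=x_1^m,\dots,x_\ell^m$ and let $H_i({\bf x}^m,M)\to H_i({\bf x}^n,M)$ be the homomorphism of Koszul homology modules induced by the chain map $\mathbb K_\bullet({\bf x}^m,M)\to\mathbb K_\bullet({\bf x}^n,M)$ that is the tensor product over $j$ of the maps given by multiplication by $x_j^{m-n}$ in degree $1$ and the identity in degree $0$. The sequence ${\bf x}$ is called *$M$-weakly proregular* if for each $n$ there is $m\ge n$ such that $H_i({\bf x}^m,M)\to H_i({\bf x}^n,M)$ is zero for all $i\ge 1$. Let $H^i_{\bf x}(M)$ denote the $i$th cohomology of the Čech complex of $M$ with respect to ${\bf x}$. The sequence ${\bf x}$ is called a *parameter sequence on $M$* if (i) ${\bf x}$ is $M$-weakly proregular, (ii) ${\bf x}M\ne M$, and (iii) $H^{\ell}_{\bf x}(M)_{\mathfrak p}\neq 0$ for all primes $\mathfrak p\in\operatorname{Supp}_R(M/{\bf x}M)$. For a prime $\mathfrak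 p$ let $\operatorname{ht}_M\mathfrak p$ be the Krull dimension of the $R_{\mathfrak p}$-module $M_{\mathfrak p}$, and for an ideal $I$ let $\operatorname{ht}_M I=\inf\{\operatorname{ht}_M\mathfrak p : \mathfrak p\in\operatorname{Supp}M\cap V(I)\}$ (with $\inf\emptyset=\infty$). 1. If ${\bf x}$ is a parameter sequence on $M$, then $\operatorname{ht}_M({\bf x}R)\ge\ell({\bf x})$. 2. If moreover $R$ is Noetherian, then ${\bf x}$ is a parameter sequence on $M$ if and only if $\operatorname{ht}_M({\bf x}R)=\ell({\bf x})$. -/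

import Mathlib

/-!
Koszul homology, Čech cohomology, weakly proregular sequences, parameter sequences and the
height of an ideal on a module, for a finite sequence `x : Fin l → R` in a commutative ring `R`
and an `R`-module `M`.
-/

namespace ParamSeq

/-- The index set in degree `p` of the Koszul and Čech complexes of a sequence of length `l`:
the `p`-element subsets of the set of indices. -/
abbrev Idx (l p : ℕ) : Type := {s : Finset (Fin l) // s.card = p}

/-- The sign `(-1) ^ #{j ∈ s | j < i}`. -/
def sgn {l : ℕ} (s : Finset (Fin l)) (i : Fin l) : ℤ :=
  (-1) ^ (s.filter (fun j => j < i)).card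

theorem sgn_mul_sgn {l : ℕ} {t : Finset (Fin l)} {i j : Fin l} (hi : i ∈ t) (hj : j ∈ t)
    (hij : i ≠ j) :
    sgn t i * sgn (t.erase i) j + sgn t j * sgn (t.erase j) i = 0 := by
  have key : ∀ a b : Fin l, a ∈ t → b ∈ t → a < b →
      sgn t a * sgn (t.erase a) b + sgn t b * sgn (t.erase b) a = 0 := by
    intro a b ha hb hab
    have h1 : (t.erase b).filter (fun k => k < a) = t.filter (fun k => k < a) := by
      ext k
      simp only [Finset.mem_filter, Finset.mem_erase]
      constructor
      · rintro ⟨⟨-, h⟩, h'⟩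
        exact ⟨h, h'⟩
      · rintro ⟨h, h'⟩
        exact ⟨⟨(h'.trans hab).ne, h⟩, h'⟩
    have h2 : (t.erase a).filter (fun k => k < b) = (t.filter (fun k => k < b)).erase a := by
      ext k
      simp only [Finset.mem_filter, Finset.mem_erase]
      tauto
    have h3 : a ∈ t.filter (fun k => k < b) := by simp [ha, hab]
    have h4 := Finset.card_erase_add_one h3
    unfold sgn
    rw [h1, h2, ← h4, pow_succ]
    ring
  rcases lt_or_gt_of_ne hij with h | h
  · exact key i j hi hj h
  · rw [add_comm]
    exact key j i hj hi h

section Koszul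

variable {R : Type*} [CommRing R] {l : ℕ}

/-- The degree `p` term of the Koszul complex `K(x, M)` of a sequence of length `l`: the direct sum
of copies of `M`, one for each basis element `e_s = e_{i₁} ∧ ⋯ ∧ e_{i_p}` of the
`p`-th exterior power of `R ^ l`, where `s = {i₁ < ⋯ < i_p}`. -/
abbrev KoszulTerm (M : Type*) (l p : ℕ) : Type _ := Idx l p → M

/-- The Koszul differential `K_{p+1}(x, M) → K_p(x, M)`, that is
`e_t ⊗ m ↦ ∑ i ∈ t, ± e_{t \ i} ⊗ x_i m`: the coefficient of `d m` at `s` is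
`∑ i ∉ s, ± x_i m_{s ∪ {i}}`. -/
def koszulD (x : Fin l → R) (M : Type*) [AddCommGroup M] [Module R M] (p : ℕ) :
    KoszulTerm M l (p + 1) →ₗ[R] KoszulTerm M l p :=
  LinearMap.pi fun s => ∑ i : {i : Fin l // i ∉ s.1},
    ((sgn s.1 i.1 : R) * x i.1) • LinearMap.proj
      (⟨insert i.1 s.1, by rw [Finset.card_insert_of_notMem i.2, s.2]⟩ : Idx l (p + 1))

/-- The cycles of the Koszul complex in degree `p`. -/
def koszulCycles (x : Fin l → R) (M : Type*) [AddCommGroup M] [Module R M] :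
    (p : ℕ) → Submodule R (KoszulTerm M l p)
  | 0 => ⊤
  | p + 1 => LinearMap.ker (koszulD x M p)

/-- The Koszul homology `H_p(x, M)`, cycles modulo boundaries. -/
abbrev KoszulHomology (x : Fin l → R) (M : Type*) [AddCommGroup M] [Module R M] (p : ℕ) :
    Type _ :=
  koszulCycles x M p ⧸ (LinearMap.range (koszulD x M p)).submoduleOf (koszulCycles x M p)

theorem koszulD_apply (x : Fin l → R) (M : Type*) [AddCommGroup M] [Module R M] (p : ℕ)
    (m : KoszulTerm M l (p + 1)) (s : Idx l p) :
    koszulD x M p m s = ∑ i : {i : Fin l // i ∉ s.1}, ((sgn s.1 i.1 : R) * x i.1) •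
      m ⟨insert i.1 s.1, by rw [Finset.card_insert_of_notMem i.2, s.2]⟩ := by
  simp [koszulD, LinearMap.sum_apply]

theorem koszulD_koszulD (x : Fin l → R) (M : Type*) [AddCommGroup M] [Module R M] (p : ℕ)
    (m : KoszulTerm M l (p + 2)) : koszulD x M p (koszulD x M (p + 1) m) = 0 := by
  funext s
  simp only [koszulD_apply, Finset.smul_sum, Pi.zero_apply]
  rw [Finset.sum_sigma']
  have hmem : ∀ a : (Σ i : {i : Fin l // i ∉ s.1}, {j : Fin l // j ∉ insert i.1 s.1}),
      a.2.1 ∉ s.1 ∧ a.1.1 ∉ insert a.2.1 s.1 ∧ a.1.1 ≠ a.2.1 := by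
    rintro ⟨⟨i, hi⟩, ⟨j, hj⟩⟩
    simp only [Finset.mem_insert, not_or] at hj ⊢
    exact ⟨hj.2, ⟨fun h => hj.1 h.symm, hi⟩, fun h => hj.1 h.symm⟩
  refine Finset.sum_involution
    (fun a _ => ⟨⟨a.2.1, (hmem a).1⟩, ⟨a.1.1, (hmem a).2.1⟩⟩) ?_ ?_ ?_ ?_
  · rintro ⟨⟨i, hi⟩, ⟨j, hj⟩⟩ -
    have hji : j ≠ i ∧ j ∉ s.1 := by simpa using hj
    have hset : insert i (insert j s.1) = insert j (insert i s.1) := Finset.insert_comm _ _ _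
    have e1 : (insert j (insert i s.1)).erase j = insert i s.1 := Finset.erase_insert hj
    have e2 : (insert j (insert i s.1)).erase i = insert j s.1 := by
      rw [← hset, Finset.erase_insert]
      simp [hi, hji.1.symm]
    have hs1 : sgn (insert i s.1) i = sgn s.1 i := by
      simp [sgn, Finset.filter_insert]
    have hs2 : sgn (insert j s.1) j = sgn s.1 j := by
      simp [sgn, Finset.filter_insert]
    have hs3 : sgn (insert j (insert i s.1)) j = sgn (insert i s.1) j := by
      simp [sgn, Finset.filter_insert]
    have hs4 : sgn (insert j (insert i s.1)) i = sgn (insert j s.1) i := by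
      rw [← hset]
      simp [sgn, Finset.filter_insert]
    have hsg := sgn_mul_sgn (t := insert j (insert i s.1)) (i := i) (j := j)
      (by simp) (by simp) hji.1.symm
    rw [e1, e2, hs1, hs2, hs3, hs4] at hsg
    simp only [hset, smul_smul, ← add_smul]
    convert zero_smul R _
    have hsg' : ((sgn (insert j s.1) i * sgn s.1 j + sgn (insert i s.1) j * sgn s.1 i : ℤ) : R)
        = 0 := by
      rw [hsg]; simp
    push_cast at hsg'
    linear_combination (x i * x j) * hsg'
  · intro a _ _ h
    exact (hmem a).2.2 (congrArg (fun b => b.1.1) h).symm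
  · intro a _
    simp
  · intro a _
    rfl

/-- The degree `p` component of the chain map `φ : K(x^m, M) → K(x^n, M)`, `n ≤ m`: the tensor
product over `i` of the maps that are `x_i ^ (m - n)` in degree one and the identity in degree
zero, hence multiplication by `∏ i ∈ s, x_i ^ (m - n)` on the summand of index `s`. -/
def koszulMap (x : Fin l → R) (M : Type*) [AddCommGroup M] [Module R M] (m n p : ℕ) :
    KoszulTerm M l p →ₗ[R] KoszulTerm M l p :=
  LinearMap.pi fun s => (∏ i ∈ s.1, x i ^ (m - n)) • LinearMap.proj s

theorem koszulD_koszulMap (x : Fin l → R) (M : Type*) [AddCommGroup M] [Module R M] {m n : ℕ}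
    (h : n ≤ m) (p : ℕ) (z : KoszulTerm M l (p + 1)) :
    koszulD (fun i => x i ^ n) M p (koszulMap x M m n (p + 1) z) =
      koszulMap x M m n p (koszulD (fun i => x i ^ m) M p z) := by
  funext s
  simp only [koszulD_apply, koszulMap, LinearMap.pi_apply, LinearMap.smul_apply,
    LinearMap.proj_apply, Finset.smul_sum]
  refine Finset.sum_congr rfl fun i _ => ?_
  rw [Finset.prod_insert i.2, smul_smul, smul_smul]
  congr 1
  have : x i.1 ^ m = x i.1 ^ n * x i.1 ^ (m - n) := by rw [← pow_add, Nat.add_sub_cancel' h]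
  rw [this]
  ring

theorem koszulMap_mem_cycles (x : Fin l → R) (M : Type*) [AddCommGroup M] [Module R M] {m n : ℕ}
    (h : n ≤ m) (p : ℕ) (z : KoszulTerm M l p) (hz : z ∈ koszulCycles (fun i => x i ^ m) M p) :
    koszulMap x M m n p z ∈ koszulCycles (fun i => x i ^ n) M p := by
  cases p with
  | zero => trivial
  | succ p =>
    change koszulD _ M p _ = 0
    rw [koszulD_koszulMap x M h, show koszulD _ M p z = 0 from hz, map_zero]

/-- The homomorphism `H_p(x^m, M) → H_p(x^n, M)` induced by the chain map `koszulMap`. -/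
def koszulHomologyMap (x : Fin l → R) (M : Type*) [AddCommGroup M] [Module R M] {m n : ℕ}
    (h : n ≤ m) (p : ℕ) :
    KoszulHomology (fun i => x i ^ m) M p →ₗ[R] KoszulHomology (fun i => x i ^ n) M p :=
  Submodule.mapQ _ _
    ((koszulMap x M m n p).restrict fun z hz => koszulMap_mem_cycles x M h p z hz) (by
      rintro ⟨z, hz⟩ ⟨w, hw⟩
      exact ⟨koszulMap x M m n (p + 1) w, by
        rw [koszulD_koszulMap x M h, hw]; rfl⟩)

/-- The sequence `x` is `M`-weakly proregular: for each `n` there is `m ≥ n` such that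
`H_i(x^m, M) → H_i(x^n, M)` is zero for all `i ≥ 1`. -/
def IsWeaklyProregular (x : Fin l → R) (M : Type*) [AddCommGroup M] [Module R M] : Prop :=
  ∀ n : ℕ, ∃ (m : ℕ) (h : n ≤ m), ∀ i : ℕ, 1 ≤ i → koszulHomologyMap x M h i = 0

end Koszul

section Cech

variable {R : Type*} [CommRing R] {l : ℕ}

/-- The localization of `M` at the product of the `x_i`, `i ∈ s`. -/
abbrev CechLoc (x : Fin l → R) (M : Type*) [AddCommGroup M] [Module R M]
    (s : Finset (Fin l)) : Type _ :=
  LocalizedModule (Submonoid.powers (∏ i ∈ s, x i)) M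

theorem isUnit_cechLoc (x : Fin l → R) (M : Type*) [AddCommGroup M] [Module R M]
    {s t : Finset (Fin l)} (h : s ⊆ t) (a : Submonoid.powers (∏ i ∈ s, x i)) :
    IsUnit (algebraMap R (Module.End R (CechLoc x M t)) a) := by
  obtain ⟨_, k, rfl⟩ := a
  have hu : IsUnit (algebraMap R (Module.End R (CechLoc x M t)) ((∏ i ∈ t, x i) ^ k)) :=
    IsLocalizedModule.map_units (LocalizedModule.mkLinearMap (Submonoid.powers (∏ i ∈ t, x i)) M)
      (⟨_, k, rfl⟩ : Submonoid.powers (∏ i ∈ t, x i))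
  have hp : (∏ i ∈ t, x i) ^ k = (∏ i ∈ s, x i) ^ k * (∏ i ∈ t \ s, x i) ^ k := by
    rw [← mul_pow, mul_comm, Finset.prod_sdiff h]
  rw [hp, map_mul] at hu
  change IsUnit (algebraMap R (Module.End R (CechLoc x M t)) ((∏ i ∈ s, x i) ^ k))
  have hc : Commute (algebraMap R (Module.End R (CechLoc x M t)) ((∏ i ∈ s, x i) ^ k))
      (algebraMap R (Module.End R (CechLoc x M t)) ((∏ i ∈ t \ s, x i) ^ k)) :=
    Algebra.commutes _ _
  exact (hc.isUnit_mul_iff.1 hu).1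

/-- For `s ⊆ t`, the natural localization map from `M` localized at `∏ i ∈ s, x_i` to `M` localized
at `∏ i ∈ t, x_i`; it sends `m / 1` to `m / 1`. -/
noncomputable def cechRes (x : Fin l → R) (M : Type*) [AddCommGroup M] [Module R M]
    {s t : Finset (Fin l)} (h : s ⊆ t) : CechLoc x M s →ₗ[R] CechLoc x M t :=
  LocalizedModule.lift (Submonoid.powers (∏ i ∈ s, x i))
    (LocalizedModule.mkLinearMap (Submonoid.powers (∏ i ∈ t, x i)) M)
    (isUnit_cechLoc x M h)

theorem cechRes_cechRes (x : Fin l → R) (M : Type*) [AddCommGroup M] [Module R M]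
    {s t u : Finset (Fin l)} (h : s ⊆ t) (h' : t ⊆ u) (z : CechLoc x M s) :
    cechRes x M h' (cechRes x M h z) = cechRes x M (h.trans h') z := by
  have : (cechRes x M h').comp (cechRes x M h) = cechRes x M (h.trans h') := by
    refine (LocalizedModule.lift_unique _ _ (isUnit_cechLoc x M (h.trans h')) _ ?_).symm
    simp only [cechRes]
    rw [LinearMap.comp_assoc, LocalizedModule.lift_comp, LocalizedModule.lift_comp]
  exact LinearMap.congr_fun this z

/-- The degree `p` term of the Čech complex `C(x; M)`: the direct sum of the localizations of `M`
at the products of `p` terms of the sequence. -/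
abbrev CechTerm (x : Fin l → R) (M : Type*) [AddCommGroup M] [Module R M] (p : ℕ) : Type _ :=
  (s : Idx l p) → CechLoc x M s.1

/-- The Čech differential `C^p(x; M) → C^{p+1}(x; M)`: the component of `d m` at `t` is
`∑ i ∈ t, ± m_{t \ {i}}`. -/
noncomputable def cechD (x : Fin l → R) (M : Type*) [AddCommGroup M] [Module R M] (p : ℕ) :
    CechTerm x M p →ₗ[R] CechTerm x M (p + 1) :=
  LinearMap.pi fun t => ∑ i : {i : Fin l // i ∈ t.1},
    (sgn t.1 i.1 : R) • (cechRes x M (Finset.erase_subset i.1 t.1)).comp (LinearMap.proj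
      (⟨t.1.erase i.1, by rw [Finset.card_erase_of_mem i.2, t.2, Nat.add_sub_cancel]⟩ : Idx l p))

theorem cechD_apply (x : Fin l → R) (M : Type*) [AddCommGroup M] [Module R M] (p : ℕ)
    (m : CechTerm x M p) (t : Idx l (p + 1)) :
    cechD x M p m t = ∑ i : {i : Fin l // i ∈ t.1}, (sgn t.1 i.1 : R) •
      cechRes x M (Finset.erase_subset i.1 t.1)
        (m ⟨t.1.erase i.1, by rw [Finset.card_erase_of_mem i.2, t.2, Nat.add_sub_cancel]⟩) := by
  simp [cechD, LinearMap.sum_apply]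

theorem cechD_cechD (x : Fin l → R) (M : Type*) [AddCommGroup M] [Module R M] (p : ℕ)
    (m : CechTerm x M p) : cechD x M (p + 1) (cechD x M p m) = 0 := by
  funext t
  simp only [cechD_apply, Finset.smul_sum, Pi.zero_apply, map_sum, map_smul, cechRes_cechRes]
  rw [Finset.sum_sigma']
  have hmem : ∀ a : (Σ i : {i : Fin l // i ∈ t.1}, {j : Fin l // j ∈ t.1.erase i.1}),
      a.2.1 ∈ t.1 ∧ a.1.1 ∈ t.1.erase a.2.1 ∧ a.1.1 ≠ a.2.1 := by
    rintro ⟨⟨i, hi⟩, ⟨j, hj⟩⟩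
    simp only [Finset.mem_erase] at hj ⊢
    exact ⟨hj.2, ⟨fun h => hj.1 h.symm, hi⟩, fun h => hj.1 h.symm⟩
  have aux : ∀ (s s' : Idx l p) (hs : s.1 ⊆ t.1) (hs' : s'.1 ⊆ t.1), s = s' →
      cechRes x M hs (m s) = cechRes x M hs' (m s') := by
    rintro s _ _ _ rfl
    rfl
  refine Finset.sum_involution
    (fun a _ => ⟨⟨a.2.1, (hmem a).1⟩, ⟨a.1.1, (hmem a).2.1⟩⟩) ?_ ?_ ?_ ?_
  · rintro ⟨⟨i, hi⟩, ⟨j, hj⟩⟩ -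
    have hji : j ≠ i ∧ j ∈ t.1 := by simpa using hj
    have hsg := sgn_mul_sgn hi hji.2 hji.1.symm
    rw [aux ⟨(t.1.erase j).erase i, _⟩ ⟨(t.1.erase i).erase j, by
      rw [Finset.card_erase_of_mem hj, Finset.card_erase_of_mem hi, t.2]; rfl⟩ _
      ((Finset.erase_subset _ _).trans (Finset.erase_subset _ _))
      (Subtype.ext Finset.erase_right_comm)]
    rw [smul_smul, smul_smul, ← add_smul, ← Int.cast_mul, ← Int.cast_mul, ← Int.cast_add, hsg,
      Int.cast_zero, zero_smul]
  · intro a _ _ h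
    exact (hmem a).2.2 (congrArg (fun b => b.1.1) h).symm
  · intro a _
    simp
  · intro a _
    rfl

/-- The coboundaries of the Čech complex in degree `p`. -/
noncomputable def cechBoundaries (x : Fin l → R) (M : Type*) [AddCommGroup M] [Module R M] :
    (p : ℕ) → Submodule R (CechTerm x M p)
  | 0 => ⊥
  | p + 1 => LinearMap.range (cechD x M p)

/-- The Čech cohomology `H^p_x(M)`, cocycles modulo coboundaries. -/
abbrev CechCohomology (x : Fin l → R) (M : Type*) [AddCommGroup M] [Module R M] (p : ℕ) :
    Type _ :=
  LinearMap.ker (cechD x M p) ⧸ (cechBoundaries x M p).submoduleOf (LinearMap.ker (cechD x M p))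

end Cech

/-- The finite sequence `x` of length `l` is a parameter sequence on `M`: it is `M`-weakly
proregular, `xM ≠ M`, and `H^l_x(M)` localized at `p` is nonzero for all primes `p` in the
support of `M / xM`. -/
structure IsParameterSequence {R : Type*} [CommRing R] {l : ℕ} (x : Fin l → R)
    (M : Type*) [AddCommGroup M] [Module R M] : Prop where
  weaklyProregular : IsWeaklyProregular x M
  smul_ne_top : Ideal.span (Set.range x) • (⊤ : Submodule R M) ≠ ⊤
  nontrivial_localization :
    ∀ p ∈ Module.support R (M ⧸ Ideal.span (Set.range x) • (⊤ : Submodule R M)),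
      Nontrivial (LocalizedModule p.asIdeal.primeCompl (CechCohomology x M l))

/-- The height `ht_M p` of a prime `p` on `M`: the Krull dimension of the `R_p`-module `M_p`. -/
noncomputable def primeHeightOn {R : Type*} [CommRing R] (M : Type*) [AddCommGroup M]
    [Module R M] (p : PrimeSpectrum R) : WithBot ℕ∞ :=
  Module.supportDim (Localization.AtPrime p.asIdeal) (LocalizedModule p.asIdeal.primeCompl M)

/-- The height `ht_M I` of an ideal `I` on `M`: the infimum of `ht_M p` over the primes
`p ∈ Supp M ∩ V(I)`; it is `⊤` if there are none. -/
noncomputable def heightOn {R : Type*} [CommRing R] (M : Type*) [AddCommGroup M]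
    [Module R M] (I : Ideal R) : WithBot ℕ∞ :=
  ⨅ p ∈ Module.support R M ∩ PrimeSpectrum.zeroLocus (I : Set R), primeHeightOn M p

end ParamSeq

/-! Top Čech cohomology is the direct limit of the quotients `M / (x_1^n, …, x_l^n) M`: the class of
`m / (∏ x_i)^n` vanishes exactly when `(∏ x_i)^k m` lies in `(x_1^(n+k), …, x_l^(n+k)) M` for some
`k` (`cechTop_mem_boundaries_iff`). This criterion also handles localizations of `H^l_x(M)`.

The lower bound on the height rests on a fact about arbitrary commutative rings: in dimension less
than `l`, any `l` elements satisfy `(∏ y_i)^k ∈ (y_i^(k+1))` for some `k`. Applied to `R_p /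
Ann(M_p)`, it makes `H^l_x(M)_p` vanish when `dim M_p < l`, so nonvanishing on `Supp (M / xM) = Supp
M ∩ V(x)` forces `ht ≥ l`.

Over a Noetherian ring every sequence is weakly proregular, and Krull's height theorem gives `dim
M_q ≤ l` for `q` minimal over `Ann M + (x)`; this is the reverse inequality. Conversely, if the
height is `l`, then `dim M_q = l` and `x` cuts out only the closed point of `Supp M_q`, so
Grothendieck nonvanishing gives `H^l_x(M)_q ≠ 0`. This passes to every prime `p ⊇ q`, since `M_q` is
a further localization of `M_p`.

Grothendieck nonvanishing is proved with long exact sequences and prime filtrations: Čech cohomology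
vanishes above the dimension, and is Artinian when `x` meets the support only in maximal ideals. If
`H^(d+1)(A/P)` vanished with `dim A/P = d + 1 ≥ 2`, the infinitely many primes `Q ⊃ P` with `dim A/Q
= d` would yield a strictly descending chain of submodules of the Artinian module `H^d(A/P)`. A
nonzero map from the module to some `A/P` of full dimension reduces the general case to this one. -/

namespace ParamSeq

-- Krull dimension and relations between powers of elements.

universe u v

/-- Primes of the localization are primes of `A` disjoint from `S`. Such a prime omits `a`, and it
is not comaximal with `a`, since `1 - b * a` lies in `S`. A maximal ideal containing both therefore
extends every chain by one step. -/
theorem lt_of_boundary_localization {A B : Type*} [CommRing A] [CommRing B] [Algebra A B] (a : A)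
    (S : Submonoid A) [IsLocalization S B] (hS : ∀ s : A, (∃ N b, s = a ^ N * (1 + a * b)) → s ∈ S)
    {l : ℕ} (h : ringKrullDim A < ((l + 1 : ℕ) : WithBot ℕ∞)) :
    ringKrullDim B < (l : WithBot ℕ∞) := by
  by_contra! hB
  obtain ⟨c, hc⟩ := Order.le_krullDim_iff.1 hB
  have hmono : StrictMono (PrimeSpectrum.comap (algebraMap A B)) := by
    refine Monotone.strictMono_of_injective (fun p q hpq => Ideal.comap_mono hpq) ?_
    exact PrimeSpectrum.localization_comap_injective B S
  let c' := c.map _ hmono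
  have hdisj : Disjoint (S : Set A) (c'.last.asIdeal : Set A) := by
    have := PrimeSpectrum.localization_comap_range B S
    have hm : c'.last ∈ Set.range (PrimeSpectrum.comap (algebraMap A B)) := ⟨c.last, rfl⟩
    rw [this] at hm
    exact hm
  have hne : c'.last.asIdeal ⊔ Ideal.span {a} ≠ ⊤ := by
    intro htop
    have h1 : (1 : A) ∈ c'.last.asIdeal ⊔ Ideal.span {a} := by rw [htop]; trivial
    obtain ⟨y, hy, z, hz, hyz⟩ := Submodule.mem_sup.1 h1
    obtain ⟨b, rfl⟩ := Ideal.mem_span_singleton'.1 hz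
    refine Set.disjoint_left.1 hdisj (hS y ⟨0, -b, ?_⟩) hy
    rw [← hyz]
    ring
  obtain ⟨m, hm, hle⟩ := Ideal.exists_le_maximal _ hne
  have ha : a ∈ m := hle (Ideal.mem_sup_right (Ideal.mem_span_singleton_self a))
  have hlt : c'.last < (⟨m, hm.isPrime⟩ : PrimeSpectrum A) := by
    refine lt_of_le_of_ne (show c'.last.asIdeal ≤ m from le_sup_left.trans hle) fun he => ?_
    have ha' : a ∈ c'.last.asIdeal := by rw [he]; exact ha
    exact Set.disjoint_left.1 hdisj (hS a ⟨1, 0, by simp⟩) ha'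
  have hlen : (((c'.snoc _ hlt).length : ℕ) : WithBot ℕ∞) ≤ ringKrullDim A :=
    Order.le_krullDim_iff.2 ⟨_, rfl⟩
  have : (c'.snoc _ hlt).length = l + 1 := by simp [c', hc]
  rw [this] at hlen
  exact absurd h (not_lt.2 hlen)

/-- The submonoid of the elements `a ^ N * (1 + a * b)`. -/
def boundarySubmonoid {A : Type*} [CommRing A] (a : A) : Submonoid A where
  carrier := {s | ∃ N b, s = a ^ N * (1 + a * b)}
  one_mem' := ⟨0, 0, by simp⟩
  mul_mem' := by
    rintro _ _ ⟨N, b, rfl⟩ ⟨N', b', rfl⟩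
    exact ⟨N + N', b + b' + a * b * b', by ring⟩

theorem prod_pow_mem_span_pow_of_le {A : Type*} [CommRing A] {l : ℕ} (x : Fin l → A) {k K : ℕ}
    (h : k ≤ K) {s : A} (hs : s * (∏ i, x i) ^ k ∈ Ideal.span (Set.range fun i => x i ^ (k + 1))) :
    s * (∏ i, x i) ^ K ∈ Ideal.span (Set.range fun i => x i ^ (K + 1)) := by
  obtain ⟨j, rfl⟩ := Nat.exists_eq_add_of_le h
  obtain ⟨c, hc⟩ := Ideal.mem_span_range_iff_exists_fun.1 hs
  rw [pow_add, ← mul_assoc, ← hc, Finset.sum_mul]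
  refine Ideal.sum_mem _ fun i _ => ?_
  obtain ⟨y, hy⟩ := Finset.dvd_prod_of_mem x (Finset.mem_univ i)
  have : c i * x i ^ (k + 1) * (∏ i, x i) ^ j = c i * y ^ j * x i ^ (k + j + 1) := by
    rw [hy]; ring
  rw [this]
  exact Ideal.mul_mem_left _ _ (Ideal.subset_span ⟨i, rfl⟩)

/-- Localizing at the elements `x 0 ^ N * (1 + x 0 * b)` lowers the dimension, so induction applies
to the other `l` elements there. Clearing the denominator gives a relation in `A` whose unwanted
term `x 0 * b` is absorbed by the generator `x 0 ^ (K + 1)`. -/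
theorem exists_prod_pow_mem_of_ringKrullDim_lt {l : ℕ} :
    ∀ {A : Type*} [CommRing A] (x : Fin l → A), ringKrullDim A < (l : WithBot ℕ∞) →
      ∃ k, (∏ i, x i) ^ k ∈ Ideal.span (Set.range fun i => x i ^ (k + 1)) := by
  induction l with
  | zero =>
    intro A _ x h
    have : Subsingleton A := by
      by_contra hA
      rw [not_subsingleton_iff_nontrivial] at hA
      exact absurd h (not_lt.2 ringKrullDim_nonneg_of_nontrivial)
    exact ⟨0, by rw [Subsingleton.elim ((∏ i, x i) ^ 0) 0]; exact zero_mem _⟩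
  | succ l ih =>
    intro A _ x h
    let S := boundarySubmonoid (x 0)
    let B := Localization S
    have hB : ringKrullDim B < (l : WithBot ℕ∞) :=
      lt_of_boundary_localization (x 0) S (fun s hs => hs) h
    obtain ⟨k, hk⟩ := ih (fun i : Fin l => algebraMap A B (x i.succ)) hB
    have hspan : Ideal.span (Set.range fun i : Fin l => algebraMap A B (x i.succ) ^ (k + 1)) =
        (Ideal.span (Set.range fun i : Fin l => x i.succ ^ (k + 1))).map (algebraMap A B) := by
      rw [Ideal.map_span, ← Set.range_comp]
      simp [Function.comp_def]
    rw [hspan, ← map_prod, ← map_pow, IsLocalization.algebraMap_mem_map_algebraMap_iff S] at hk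
    obtain ⟨_, ⟨N, b, rfl⟩, hs⟩ := hk
    -- The exponent must reach both `k`, for the relation among the remaining elements, and `N`, to
    -- supply the factor `x 0 ^ N` of the denominator.
    refine ⟨max k N, ?_⟩
    have h2 := prod_pow_mem_span_pow_of_le (fun i : Fin l => x i.succ) (le_max_left k N) hs
    have hsub : Ideal.span (Set.range fun i : Fin l => x i.succ ^ (max k N + 1)) ≤
        Ideal.span (Set.range fun i => x i ^ (max k N + 1)) :=
      Ideal.span_mono (by rintro _ ⟨i, rfl⟩; exact ⟨i.succ, rfl⟩)
    have h3 := Ideal.mul_mem_left _ (x 0 ^ (max k N - N)) (hsub h2)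
    have h4 : x 0 ^ (max k N + 1) ∈ Ideal.span (Set.range fun i => x i ^ (max k N + 1)) :=
      Ideal.subset_span ⟨0, rfl⟩
    have h5 : x 0 ^ max k N = x 0 ^ (max k N - N) * x 0 ^ N := by
      rw [← pow_add, Nat.sub_add_cancel (le_max_right _ _)]
    have : (∏ i, x i) ^ max k N =
        x 0 ^ (max k N - N) * (x 0 ^ N * (1 + x 0 * b) * (∏ i : Fin l, x i.succ) ^ max k N) -
          b * (∏ i : Fin l, x i.succ) ^ max k N * x 0 ^ (max k N + 1) := by
      rw [Fin.prod_univ_succ, mul_pow, pow_succ (x 0), h5]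
      ring
    rw [this]
    exact Ideal.sub_mem _ h3 (Ideal.mul_mem_left _ _ h4)

theorem mem_span_range_smul_top_iff {R ι M : Type*} [CommRing R] [AddCommGroup M] [Module R M]
    [Fintype ι] (f : ι → R) (z : M) :
    z ∈ Ideal.span (Set.range f) • (⊤ : Submodule R M) ↔ ∃ m : ι → M, z = ∑ i, f i • m i := by
  constructor
  · intro hz
    refine Submodule.smul_induction_on hz (fun r hr n _ => ?_) fun a b ha hb => ?_
    · obtain ⟨c, rfl⟩ := Ideal.mem_span_range_iff_exists_fun.1 hr
      exact ⟨fun i => c i • n, by simp [Finset.sum_smul, smul_smul, mul_comm]⟩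
    · obtain ⟨m, rfl⟩ := ha
      obtain ⟨m', rfl⟩ := hb
      exact ⟨m + m', by simp [Finset.sum_add_distrib]⟩
  · rintro ⟨m, rfl⟩
    exact Submodule.sum_mem _ fun i _ =>
      Submodule.smul_mem_smul (Ideal.subset_span ⟨i, rfl⟩) trivial

theorem sgn_mul_self {R : Type*} [CommRing R] {l : ℕ} (s : Finset (Fin l)) (j : Fin l) :
    (sgn s j : R) * (sgn s j : R) = 1 := by
  rw [← Int.cast_mul, sgn, ← mul_pow]
  simp

/-! ### Fractions with a prescribed exponent in the Čech terms. -/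

section Fractions

variable {R : Type*} [CommRing R] {l : ℕ} (x : Fin l → R) (M : Type*) [AddCommGroup M] [Module R M]

/-- The linear map `m ↦ m / (∏ i ∈ s, x i) ^ n`. -/
noncomputable def cechFrac (s : Finset (Fin l)) (n : ℕ) : M →ₗ[R] CechLoc x M s where
  toFun m := LocalizedModule.mk m ⟨(∏ i ∈ s, x i) ^ n, n, rfl⟩
  map_add' m m' := by
    rw [LocalizedModule.mk_add_mk, ← smul_add, LocalizedModule.mk_cancel_common_left]
  map_smul' r m := by rw [RingHom.id_apply, LocalizedModule.smul'_mk]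

theorem cechFrac_apply (s : Finset (Fin l)) (n : ℕ) (m : M) :
    cechFrac x M s n m = LocalizedModule.mk m
      (⟨(∏ i ∈ s, x i) ^ n, n, rfl⟩ : Submonoid.powers (∏ i ∈ s, x i)) := rfl

theorem cechFrac_eq_zero_iff {s : Finset (Fin l)} {n : ℕ} {m : M} :
    cechFrac x M s n m = 0 ↔ ∃ k, (∏ i ∈ s, x i) ^ k • m = 0 := by
  rw [cechFrac_apply, ← LocalizedModule.zero_mk 1, LocalizedModule.mk_eq]
  simp only [smul_zero, one_smul]
  constructor
  · rintro ⟨⟨_, k, rfl⟩, h⟩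
    exact ⟨k, h⟩
  · rintro ⟨k, h⟩
    exact ⟨⟨_, k, rfl⟩, h⟩

theorem cechFrac_add {s : Finset (Fin l)} (n k : ℕ) (m : M) :
    cechFrac x M s (n + k) ((∏ i ∈ s, x i) ^ k • m) = cechFrac x M s n m := by
  rw [cechFrac_apply, cechFrac_apply, LocalizedModule.mk_eq]
  refine ⟨1, ?_⟩
  simp only [one_smul, Submonoid.smul_def, smul_smul, pow_add]

theorem exists_cechFrac_eq {s : Finset (Fin l)} (w : CechLoc x M s) :
    ∃ n, ∀ a, n ≤ a → ∃ m, cechFrac x M s a m = w := by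
  induction w using LocalizedModule.induction_on with
  | h m d =>
    obtain ⟨_, n, rfl⟩ := d
    refine ⟨n, fun a h => ?_⟩
    obtain ⟨k, rfl⟩ := Nat.exists_eq_add_of_le h
    exact ⟨_, cechFrac_add x M (s := s) n k m⟩

/-- A common exponent for finitely many fractions, so that a cochain can be manipulated through
numerators alone. -/
theorem exists_cechFrac_eq_forall {ι : Type*} [Finite ι] (s : ι → Finset (Fin l))
    (w : ∀ i, CechLoc x M (s i)) : ∃ n, ∀ a, n ≤ a → ∀ i, ∃ m, cechFrac x M (s i) a m = w i := by
  choose n hn using fun i => exists_cechFrac_eq x M (w i)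
  have := Fintype.ofFinite ι
  exact ⟨Finset.univ.sup n, fun a ha i => hn i a ((Finset.le_sup (Finset.mem_univ i)).trans ha)⟩

theorem pow_smul_cechLoc_injective {s t : Finset (Fin l)} (h : s ⊆ t) (n : ℕ) :
    Function.Injective fun w : CechLoc x M t => (∏ i ∈ s, x i) ^ n • w :=
  ((Module.End.isUnit_iff _).1 (isUnit_cechLoc x M h ⟨_, n, rfl⟩)).1

theorem pow_smul_cechFrac (s : Finset (Fin l)) (n : ℕ) (m : M) :
    (∏ i ∈ s, x i) ^ n • cechFrac x M s n m = cechFrac x M s 0 m := by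
  rw [← map_smul]
  simpa using cechFrac_add x M 0 n m

theorem cechRes_cechFrac_zero {s t : Finset (Fin l)} (h : s ⊆ t) (m : M) :
    cechRes x M h (cechFrac x M s 0 m) = cechFrac x M t 0 m := by
  have := LocalizedModule.lift_comp (Submonoid.powers (∏ i ∈ s, x i))
    (LocalizedModule.mkLinearMap (Submonoid.powers (∏ i ∈ t, x i)) M) (isUnit_cechLoc x M h)
  have h1 := LinearMap.congr_fun this m
  simp only [LinearMap.comp_apply, LocalizedModule.mkLinearMap_apply] at h1
  have h2 : ∀ u : Finset (Fin l), cechFrac x M u 0 m = LocalizedModule.mk m 1 := fun u => by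
    rw [cechFrac_apply]
    congr 1
    exact Subtype.ext (pow_zero _)
  rw [h2, h2]
  exact h1

theorem cechRes_cechFrac {s t : Finset (Fin l)} (h : s ⊆ t) (n : ℕ) (m : M) :
    cechRes x M h (cechFrac x M s n m) = cechFrac x M t n ((∏ i ∈ t \ s, x i) ^ n • m) := by
  apply pow_smul_cechLoc_injective x M h n
  apply pow_smul_cechLoc_injective x M (Finset.sdiff_subset (s := t) (t := s)) n
  simp only
  rw [← map_smul, pow_smul_cechFrac, cechRes_cechFrac_zero, smul_smul, ← mul_pow,
    Finset.prod_sdiff h, pow_smul_cechFrac, map_smul]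

end Fractions

/-! ### Vanishing of classes in top degree. -/

section Top

variable {R : Type*} [CommRing R] {l : ℕ} (x : Fin l → R) (M : Type*) [AddCommGroup M] [Module R M]

theorem idx_self_eq_univ (s : Idx l l) : s = ⟨Finset.univ, by simp⟩ :=
  Subtype.ext ((Finset.card_eq_iff_eq_univ _).1 (by simp [s.2]))

/-- The element `m / (∏ i, x i) ^ n` of the Čech complex in top degree. -/
noncomputable def cechTop (n : ℕ) (m : M) : CechTerm x M l := fun s => cechFrac x M s.1 n m

theorem exists_cechTop_eq (c : CechTerm x M l) : ∃ n m, cechTop x M n m = c := by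
  obtain ⟨n, hn⟩ := exists_cechFrac_eq x M (c ⟨Finset.univ, by simp⟩)
  obtain ⟨m, hm⟩ := hn n le_rfl
  refine ⟨n, m, funext fun s => ?_⟩
  obtain rfl := idx_self_eq_univ s
  exact hm

/-- Each component of a cochain in degree `l - 1` omits a single index `i`, so over a common
denominator `(∏ x_i)^a` its image has a numerator of the form `∑ ± x_i^a m_i`. For `l = 0` the
boundaries are zero and both sides say `m = 0`. -/
theorem cechTop_mem_boundaries_iff {n : ℕ} {m : M} :
    cechTop x M n m ∈ cechBoundaries x M l ↔
      ∃ k, (∏ i, x i) ^ k • m ∈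
        Ideal.span (Set.range fun i => x i ^ (n + k)) • (⊤ : Submodule R M) := by
  cases l with
  | zero =>
    have h0 : cechTop x M n m = 0 ↔ m = 0 := by
      constructor
      · intro h
        obtain ⟨k, hk⟩ := (cechFrac_eq_zero_iff x M).1 (congrFun h ⟨∅, rfl⟩)
        simpa using hk
      · rintro rfl
        exact funext fun s => map_zero _
    change cechTop x M n m ∈ (⊥ : Submodule R _) ↔ _
    rw [Submodule.mem_bot, h0]
    simp
  | succ p =>
    have hcard : ∀ i : Fin (p + 1), (Finset.univ.erase i).card = p := fun i => by simp
    have hdiff : ∀ i : Fin (p + 1), Finset.univ \ Finset.univ.erase i = {i} := fun i => by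
      ext j; simp
    change cechTop x M n m ∈ LinearMap.range (cechD x M p) ↔ _
    have hsum : ∀ b : CechTerm x M p, cechD x M p b ⟨Finset.univ, by simp⟩ =
        ∑ i : Fin (p + 1), (sgn Finset.univ i : R) •
          cechRes x M (Finset.erase_subset i Finset.univ) (b ⟨Finset.univ.erase i, hcard i⟩) := by
      intro b
      rw [cechD_apply]
      exact Fintype.sum_equiv (Equiv.subtypeUnivEquiv fun i => Finset.mem_univ i) _ _ fun i => rfl
    constructor
    · rintro ⟨b, hb⟩
      obtain ⟨a₀, ha₀⟩ := exists_cechFrac_eq_forall x M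
        (fun i : Fin (p + 1) => Finset.univ.erase i) fun i => b ⟨_, hcard i⟩
      choose m' hm' using ha₀ (a₀ + n) (Nat.le_add_right _ _)
      have h := congrFun hb ⟨Finset.univ, by simp⟩
      rw [hsum] at h
      simp only [← hm', cechRes_cechFrac, hdiff, Finset.prod_singleton, ← map_smul, ← map_sum] at h
      have h2 : cechTop x M n m ⟨Finset.univ, by simp⟩ =
          cechFrac x M Finset.univ (a₀ + n) ((∏ i, x i) ^ a₀ • m) := by
        rw [add_comm a₀ n]
        exact (cechFrac_add x M n a₀ m).symm
      rw [h2, ← sub_eq_zero, ← map_sub, cechFrac_eq_zero_iff] at h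
      obtain ⟨c, hc⟩ := h
      refine ⟨c + a₀, ?_⟩
      rw [smul_sub, sub_eq_zero, smul_smul, ← pow_add] at hc
      rw [← hc, Finset.smul_sum]
      refine Submodule.sum_mem _ fun i _ => ?_
      obtain ⟨y, hy⟩ := Finset.dvd_prod_of_mem x (Finset.mem_univ i)
      have : (∏ i, x i) ^ c • (sgn Finset.univ i : R) • x i ^ (a₀ + n) • m' i =
          x i ^ (n + (c + a₀)) • (y ^ c * (sgn Finset.univ i : R)) • m' i := by
        rw [hy]
        simp only [smul_smul]
        congr 1
        ring
      rw [this]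
      exact Submodule.smul_mem_smul (Ideal.subset_span ⟨i, rfl⟩) trivial
    · rintro ⟨k, hk⟩
      obtain ⟨m', hm'⟩ := (mem_span_range_smul_top_iff _ _).1 hk
      -- The complement of `s` is a single index `i`, so the inner sum is the one term `± m' i`; its
      -- sign cancels that of the differential.
      refine ⟨fun s => cechFrac x M s.1 (n + k)
        (∑ i ∈ Finset.univ \ s.1, (sgn Finset.univ i : R) • m' i), funext fun s => ?_⟩
      obtain rfl := idx_self_eq_univ s
      rw [hsum]
      simp only [cechRes_cechFrac, hdiff, Finset.prod_singleton, Finset.sum_singleton,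
        ← map_smul, ← map_sum]
      have : ∀ i : Fin (p + 1), (sgn Finset.univ i : R) • x i ^ (n + k) •
          (sgn Finset.univ i : R) • m' i = x i ^ (n + k) • m' i := by
        intro i
        rw [smul_comm, smul_smul (sgn _ i : R), sgn_mul_self, one_smul]
      simp only [this, ← hm']
      exact cechFrac_add x M n k m

end Top

/-! ### Localized top cohomology and its vanishing below dimension `l`. -/

section TopLocalized

variable {R : Type*} [CommRing R] {l : ℕ} (x : Fin l → R) (M : Type*) [AddCommGroup M] [Module R M]

theorem exists_smul_mem_of_mk_eq_sum {M : Type*} [AddCommGroup M] [Module R M] {ι : Type*}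
    [Fintype ι] (S : Submonoid R) (f : ι → R) (z : M) (w : ι → LocalizedModule S M)
    (h : LocalizedModule.mkLinearMap S M z = ∑ i, f i • w i) :
    ∃ u ∈ S, u • z ∈ Ideal.span (Set.range f) • (⊤ : Submodule R M) := by
  obtain ⟨b, hb⟩ := IsLocalizedModule.exist_integer_multiples_of_finite S
    (LocalizedModule.mkLinearMap S M) w
  choose m hm using hb
  have h1 : LocalizedModule.mkLinearMap S M ((b : R) • z) =
      LocalizedModule.mkLinearMap S M (∑ i, f i • m i) := by
    rw [map_smul, h, map_sum, Finset.smul_sum]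
    refine Finset.sum_congr rfl fun i _ => ?_
    rw [map_smul, hm, smul_comm]
  obtain ⟨c, hc⟩ := (IsLocalizedModule.eq_iff_exists S (LocalizedModule.mkLinearMap S M)).1 h1
  refine ⟨c * b, (c * b).2, ?_⟩
  rw [← smul_smul]
  change c • (b : R) • z ∈ _
  rw [hc]
  exact Submodule.smul_mem _ _ ((mem_span_range_smul_top_iff _ _).2 ⟨m, rfl⟩)

theorem cechD_top (c : CechTerm x M l) : cechD x M l c = 0 := by
  funext t
  exact absurd t.2 (by have := Finset.card_le_univ t.1; simp at this; omega)

theorem smul_cechTop (r : R) (n : ℕ) (m : M) : r • cechTop x M n m = cechTop x M n (r • m) :=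
  funext fun s => (map_smul (cechFrac x M s.1 n) r m).symm

theorem subsingleton_localized_cechCohomology_top_iff (S : Submonoid R) :
    Subsingleton (LocalizedModule S (CechCohomology x M l)) ↔
      ∀ n (m : M), ∃ u ∈ S, ∃ k, (∏ i, x i) ^ k • u • m ∈
        Ideal.span (Set.range fun i => x i ^ (n + k)) • (⊤ : Submodule R M) := by
  rw [LocalizedModule.subsingleton_iff]
  have key : ∀ (u : R) n m, u • (Submodule.Quotient.mk ⟨cechTop x M n m, cechD_top x M _⟩ :
      CechCohomology x M l) = 0 ↔ ∃ k, (∏ i, x i) ^ k • u • m ∈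
        Ideal.span (Set.range fun i => x i ^ (n + k)) • (⊤ : Submodule R M) := by
    intro u n m
    rw [← Submodule.Quotient.mk_smul, Submodule.Quotient.mk_eq_zero, Submodule.submoduleOf, Submodule.mem_comap]
    change u • cechTop x M n m ∈ _ ↔ _
    rw [smul_cechTop, cechTop_mem_boundaries_iff]
  constructor
  · intro h n m
    obtain ⟨u, hu, h0⟩ := h (Submodule.Quotient.mk ⟨cechTop x M n m, cechD_top x M _⟩)
    exact ⟨u, hu, (key u n m).1 h0⟩
  · intro h c
    obtain ⟨⟨c, hc⟩, rfl⟩ := Submodule.Quotient.mk_surjective _ c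
    obtain ⟨n, m, rfl⟩ := exists_cechTop_eq x M c
    obtain ⟨u, hu, hk⟩ := h n m
    exact ⟨u, hu, (key u n m).2 hk⟩

theorem subsingleton_localized_cechCohomology_top_of_supportDim_lt [Module.Finite R M]
    (p : Ideal R) [p.IsPrime]
    (h : Module.supportDim (Localization.AtPrime p) (LocalizedModule p.primeCompl M) <
      (l : WithBot ℕ∞)) :
    Subsingleton (LocalizedModule p.primeCompl (CechCohomology x M l)) := by
  rw [subsingleton_localized_cechCohomology_top_iff]
  intro n m
  rw [Module.supportDim_eq_ringKrullDim_quotient_annihilator] at h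
  set I := Module.annihilator (Localization.AtPrime p) (LocalizedModule p.primeCompl M)
  let f : R → Localization.AtPrime p ⧸ I := fun r => Ideal.Quotient.mk I (algebraMap R _ r)
  -- Using the powers `x_i^n` gives the generators `x_i^(n (k + 1)) = x_i^(n + n k)`, which is the
  -- shape of the vanishing criterion with exponent `n k`.
  obtain ⟨k, hk⟩ := exists_prod_pow_mem_of_ringKrullDim_lt (fun i => f (x i) ^ n) h
  obtain ⟨c, hc⟩ := Ideal.mem_span_range_iff_exists_fun.1 hk
  choose c' hc' using fun i => Ideal.Quotient.mk_surjective (c i)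
  let y : LocalizedModule p.primeCompl M := LocalizedModule.mkLinearMap p.primeCompl M m
  have h1 : algebraMap R (Localization.AtPrime p) ((∏ i, x i) ^ (n * k)) -
      ∑ i, c' i * algebraMap R (Localization.AtPrime p) (x i ^ (n + n * k)) ∈ I := by
    rw [← Ideal.Quotient.eq_zero_iff_mem, map_sub, map_sum, sub_eq_zero]
    simp only [map_mul, hc', map_pow, map_prod]
    rw [pow_mul, ← Finset.prod_pow]
    change (∏ i, f (x i) ^ n) ^ k = ∑ i, c i * f (x i) ^ (n + n * k)
    rw [← hc]
    refine Finset.sum_congr rfl fun i _ => ?_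
    rw [← pow_mul]
    ring_nf
  have h2 := Module.mem_annihilator.1 h1 y
  rw [sub_smul, sub_eq_zero, Finset.sum_smul] at h2
  simp only [mul_comm (c' _), mul_smul, algebraMap_smul] at h2
  rw [← map_smul] at h2
  obtain ⟨u, hu, hmem⟩ := exists_smul_mem_of_mk_eq_sum p.primeCompl _ _ (fun i => c' i • y) h2
  refine ⟨u, hu, n * k, ?_⟩
  rwa [smul_comm]

end TopLocalized

/-! ### Weak proregularity for Noetherian modules. -/

section TotalKoszul

variable {R : Type*} [CommRing R] {l : ℕ} (M : Type*) [AddCommGroup M] [Module R M]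

/-- The Koszul differential on families indexed by all finite sets of indices. -/
def totalD (x : Fin l → R) : (Finset (Fin l) → M) →ₗ[R] (Finset (Fin l) → M) :=
  LinearMap.pi fun s => ∑ i ∈ sᶜ, ((sgn s i : R) * x i) • LinearMap.proj (insert i s)

theorem totalD_apply (x : Fin l → R) (f : Finset (Fin l) → M) (s : Finset (Fin l)) :
    totalD M x f s = ∑ i ∈ sᶜ, ((sgn s i : R) * x i) • f (insert i s) := by
  simp [totalD, LinearMap.sum_apply]

/-- The transition map of the Koszul complexes on families indexed by all finite sets of indices. -/
def totalMap (x : Fin l → R) (m n : ℕ) : (Finset (Fin l) → M) →ₗ[R] (Finset (Fin l) → M) :=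
  LinearMap.pi fun s => (∏ i ∈ s, x i ^ (m - n)) • LinearMap.proj s

theorem totalMap_apply (x : Fin l → R) (m n : ℕ) (f : Finset (Fin l) → M) (s : Finset (Fin l)) :
    totalMap M x m n f s = (∏ i ∈ s, x i ^ (m - n)) • f s := rfl

theorem totalMap_totalMap (x : Fin l → R) {m k n : ℕ} (h : n ≤ k) (h' : k ≤ m)
    (f : Finset (Fin l) → M) : totalMap M x k n (totalMap M x m k f) = totalMap M x m n f := by
  funext s
  simp only [totalMap_apply, smul_smul, ← Finset.prod_mul_distrib, ← pow_add]
  rw [show k - n + (m - k) = m - n by omega]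

theorem totalD_totalMap (x : Fin l → R) {m n : ℕ} (h : n ≤ m) (f : Finset (Fin l) → M) :
    totalD M (fun i => x i ^ n) (totalMap M x m n f) =
      totalMap M x m n (totalD M (fun i => x i ^ m) f) := by
  funext s
  simp only [totalD_apply, totalMap_apply, Finset.smul_sum]
  refine Finset.sum_congr rfl fun i hi => ?_
  rw [Finset.prod_insert (Finset.mem_compl.1 hi), smul_smul, smul_smul]
  congr 1
  have : x i ^ m = x i ^ n * x i ^ (m - n) := by rw [← pow_add, Nat.add_sub_cancel' h]
  rw [this]
  ring

/-- Families supported in the nonempty sets of indices less than `j`. -/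
def initialSupported (R : Type*) [CommRing R] (l : ℕ) (M : Type*) [AddCommGroup M] [Module R M]
    (j : ℕ) : Submodule R (Finset (Fin l) → M) where
  carrier := {w | w ∅ = 0 ∧ ∀ s, (∃ i ∈ s, j ≤ i.val) → w s = 0}
  add_mem' := fun ha hb => ⟨by simp [ha.1, hb.1], fun s hs => by simp [ha.2 s hs, hb.2 s hs]⟩
  zero_mem' := ⟨rfl, fun _ _ => rfl⟩
  smul_mem' := fun c a ha => ⟨by simp [ha.1], fun s hs => by simp [ha.2 s hs]⟩

/-- Exterior multiplication by the `j`-th basis vector. -/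
def insertAt (j : Fin l) (w : Finset (Fin l) → M) : Finset (Fin l) → M :=
  fun t => if j ∈ t then w (t.erase j) else 0

/-- The sign involution `(-1) ^ p` in degree `p`. -/
def signed (w : Finset (Fin l) → M) : Finset (Fin l) → M := fun s => (-1 : ℤ) ^ s.card • w s

variable {M}

theorem totalD_signed (x : Fin l → R) (w : Finset (Fin l) → M) :
    totalD M x (signed M w) = -signed M (totalD M x w) := by
  funext s
  simp only [totalD_apply, signed, Pi.neg_apply, Finset.smul_sum, ← Finset.sum_neg_distrib]
  refine Finset.sum_congr rfl fun i hi => ?_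
  rw [Finset.card_insert_of_notMem (Finset.mem_compl.1 hi), pow_succ, smul_comm]
  simp

/-- Leibniz rule for `e_j ∧ w` when `w` involves only indices below `j`. The basis vector enters in
last position, which is why the extra term carries the degree sign. -/
theorem totalD_insertAt (x : Fin l → R) (j : Fin l) {w : Finset (Fin l) → M}
    (hw : ∀ s, (∃ i ∈ s, j.val ≤ i.val) → w s = 0) :
    totalD M x (insertAt M j w) = insertAt M j (totalD M x w) + x j • signed M w := by
  funext s
  simp only [totalD_apply, insertAt, signed, Pi.add_apply, Pi.smul_apply]
  by_cases hj : j ∈ s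
  · have h0 : w s = 0 := hw s ⟨j, hj, le_rfl⟩
    rw [if_pos hj, h0, smul_zero, smul_zero, add_zero]
    have hc : (s.erase j)ᶜ = insert j sᶜ := by
      ext i; by_cases h : i = j <;> simp [h]
    rw [hc, Finset.sum_insert (by simp [hj]), hw (insert j _) ⟨j, by simp, le_rfl⟩, smul_zero,
      zero_add]
    refine Finset.sum_congr rfl fun i hi => ?_
    have his : i ∉ s := Finset.mem_compl.1 hi
    have hij : i ≠ j := fun h => his (h ▸ hj)
    rw [if_pos (Finset.mem_insert_of_mem hj), Finset.erase_insert_of_ne hij]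
    by_cases hlt : i < j
    · congr 3
      have : (s.erase j).filter (fun k => k < i) = s.filter (fun k => k < i) := by
        ext k
        simp only [Finset.mem_filter, Finset.mem_erase]
        constructor
        · rintro ⟨⟨-, h⟩, h'⟩
          exact ⟨h, h'⟩
        · rintro ⟨h, h'⟩
          exact ⟨⟨(h'.trans hlt).ne, h⟩, h'⟩
      rw [sgn, sgn, this]
    · rw [hw _ ⟨i, by simp, by omega⟩, smul_zero, smul_zero]
  · rw [if_neg hj, zero_add, Finset.sum_eq_single j]
    · rw [if_pos (Finset.mem_insert_self _ _), Finset.erase_insert hj]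
      by_cases h : ∃ i ∈ s, j.val ≤ i.val
      · rw [hw s h]; simp
      · push Not at h
        have : s.filter (fun k => k < j) = s := Finset.filter_true_of_mem fun i hi => h i hi
        rw [sgn, this, mul_comm, mul_smul, Int.cast_smul_eq_zsmul]
    · intro i _ hij
      rw [if_neg (by simp [hj, hij.symm]), smul_zero]
    · intro h
      exact absurd (Finset.mem_compl.2 hj) h

theorem exists_pow_smul_mem_of_isNoetherian {N : Type*} [AddCommGroup N] [Module R N]
    [IsNoetherian R N] (B : Submodule R N) (r : R) :
    ∃ c, ∀ k a, r ^ k • a ∈ B → ∀ d, c ≤ d → r ^ d • a ∈ B := by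
  let f : ℕ →o Submodule R N :=
    ⟨fun k => B.comap (LinearMap.lsmul R N (r ^ k)), monotone_nat_of_le_succ fun k a ha => by
      simp only [Submodule.mem_comap, LinearMap.lsmul_apply] at ha ⊢
      rw [pow_succ', mul_smul]
      exact B.smul_mem _ ha⟩
  obtain ⟨c, hc⟩ := monotone_stabilizes_iff_noetherian.2 ‹_› f
  refine ⟨c, fun k a ha d hd => ?_⟩
  have h1 : a ∈ f (max c k) := f.monotone (le_max_right c k) ha
  rw [← hc _ (le_max_left c k), hc d hd] at h1
  exact h1

/-- Induction on the number of variables used. Write `z = z₀ + e_a ∧ z₁`, with `a` the last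
variable; if `z` is a cycle, then so is `z₁`, and `x_a^m z₁` is a boundary up to sign. Noetherianity
bounds the power of `x_a` needed for this, so after transition to level `m₁` the surplus factor
`x_a^(m - m₁)` already makes `z₁` a boundary. Subtracting a boundary then leaves a cycle without
`e_a`. Degree zero is excluded since `H_0` need not die. -/
theorem exists_totalD_eq_totalMap [IsNoetherian R M] (x : Fin l → R) (j : ℕ) (hj : j ≤ l) :
    ∀ n, ∃ m₀, n ≤ m₀ ∧ ∀ m, m₀ ≤ m → ∀ z ∈ initialSupported R l M j,
      totalD M (fun i => x i ^ m) z = 0 →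
        ∃ w, totalMap M x m n z = totalD M (fun i => x i ^ n) w := by
  induction j with
  | zero =>
    refine fun n => ⟨n, le_rfl, fun m _ z hz _ => ⟨0, ?_⟩⟩
    have : z = 0 := by
      funext s
      rcases s.eq_empty_or_nonempty with rfl | ⟨i, hi⟩
      · exact hz.1
      · exact hz.2 s ⟨i, hi, Nat.zero_le _⟩
    rw [this, map_zero, map_zero]
  | succ j ih =>
    intro n
    obtain ⟨m₁, hn, h₁⟩ := ih (Nat.le_of_succ_le hj) n
    let B := (initialSupported R l M j).map (totalD M fun i => x i ^ m₁)
    let a : Fin l := ⟨j, hj⟩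
    obtain ⟨c, hc⟩ := exists_pow_smul_mem_of_isNoetherian B (x a)
    -- From `m₁` to `n` is the transition of the induction hypothesis; the further `c` guarantees `m
    -- - m₁ ≥ c`, beyond the stabilization of the colon submodules of `B`.
    refine ⟨m₁ + c, by omega, fun m hm z hz hdz => ?_⟩
    have hm₁ : m₁ ≤ m := by omega
    let z₁ : Finset (Fin l) → M := fun s => if a ∈ s then 0 else z (insert a s)
    let z₀ : Finset (Fin l) → M := fun s => if a ∈ s then 0 else z s
    have hge : ∀ s : Finset (Fin l), a ∉ s → (∃ i ∈ s, j ≤ i.val) → ∃ i ∈ s, j + 1 ≤ i.val := by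
      rintro s hs ⟨i, hi, hji⟩
      refine ⟨i, hi, Nat.lt_of_le_of_ne hji fun h => hs ?_⟩
      rwa [show a = i from Fin.ext h]
    have hz₁ : ∀ s : Finset (Fin l), (∃ i ∈ s, j ≤ i.val) → z₁ s = 0 := by
      intro s hs
      by_cases ha : a ∈ s
      · simp [z₁, ha]
      · obtain ⟨i, hi, hji⟩ := hge s ha hs
        simp only [z₁, if_neg ha]
        exact hz.2 _ ⟨i, Finset.mem_insert_of_mem hi, hji⟩
    have hz₀ : z₀ ∈ initialSupported R l M j := by
      refine ⟨by simp [z₀, hz.1], fun s hs => ?_⟩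
      by_cases ha : a ∈ s
      · simp [z₀, ha]
      · simp only [z₀, if_neg ha]
        exact hz.2 _ (hge s ha hs)
    have hdec : z = z₀ + insertAt M a z₁ := by
      funext s
      by_cases ha : a ∈ s
      · simp [z₀, z₁, insertAt, ha]
      · simp [z₀, insertAt, ha]
    have hmem_D : ∀ {y : Fin l → R} {w : Finset (Fin l) → M},
        (∀ s : Finset (Fin l), (∃ i ∈ s, j ≤ i.val) → w s = 0) →
        ∀ s : Finset (Fin l), (∃ i ∈ s, j ≤ i.val) → totalD M y w s = 0 := by
      rintro y w hw s ⟨i, hi, hji⟩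
      rw [totalD_apply]
      exact Finset.sum_eq_zero fun i' _ => by
        rw [hw _ ⟨i, Finset.mem_insert_of_mem hi, hji⟩, smul_zero]
    have hdz' := hdz
    rw [hdec, map_add, totalD_insertAt _ a hz₁] at hdz'
    have hd₁ : totalD M (fun i => x i ^ m) z₁ = 0 := by
      funext s
      by_cases ha : a ∈ s
      · exact hmem_D (y := fun i => x i ^ m) hz₁ s ⟨a, ha, le_rfl⟩
      · have h := congrFun hdz' (insert a s)
        have e0 := hmem_D (y := fun i => x i ^ m) hz₀.2 (insert a s)
          ⟨a, by simp, le_rfl⟩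
        have e1 : z₁ (insert a s) = 0 := by simp [z₁]
        simp only [Pi.add_apply, Pi.smul_apply, signed, e1, insertAt] at h
        rw [e0] at h
        simpa [ha] using h
    have hd₀ : totalD M (fun i => x i ^ m) z₀ = -(x a ^ m • signed M z₁) := by
      rw [hd₁] at hdz'
      have : insertAt M a (0 : Finset (Fin l) → M) = 0 := by funext s; simp [insertAt]
      rw [this, zero_add] at hdz'
      exact eq_neg_of_add_eq_zero_left hdz'
    have hsm : ∀ w : Finset (Fin l) → M, totalMap M x m m₁ (signed M w) =
        signed M (totalMap M x m m₁ w) := fun w => by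
      funext s
      simp only [totalMap_apply, signed]
      rw [smul_comm]
    have hss : ∀ w : Finset (Fin l) → M, signed M (signed M w) = w := fun w => by
      funext s
      simp only [signed, smul_smul, ← mul_pow]
      simp
    have hsg : ∀ (r : R) (w : Finset (Fin l) → M), signed M (r • w) = r • signed M w :=
      fun r w => by
        funext s
        simp only [signed, Pi.smul_apply]
        rw [smul_comm]
    have hng : ∀ w : Finset (Fin l) → M, signed M (-w) = -signed M w := fun w => by
      funext s
      simp [signed]
    have hmap₀ : totalMap M x m m₁ z₀ ∈ initialSupported R l M j :=
      ⟨by rw [totalMap_apply, hz₀.1, smul_zero],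
        fun s hs => by rw [totalMap_apply, hz₀.2 s hs, smul_zero]⟩
    have hneg : ∀ w ∈ initialSupported R l M j, signed M w ∈ initialSupported R l M j :=
      fun w hw => ⟨by simp [signed, hw.1], fun s hs => by simp [signed, hw.2 s hs]⟩
    have hB : x a ^ m • totalMap M x m m₁ z₁ ∈ B := by
      refine ⟨signed M (totalMap M x m m₁ z₀), hneg _ hmap₀, ?_⟩
      rw [totalD_signed, totalD_totalMap M x hm₁, hd₀, map_neg, map_smul, hsm]
      rw [hng, neg_neg, hsg, hss]
    obtain ⟨w₁, hw₁, hdw₁⟩ := hc m _ hB (m - m₁) (by omega)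
    have hins : totalMap M x m m₁ (insertAt M a z₁) =
        insertAt M a (x a ^ (m - m₁) • totalMap M x m m₁ z₁) := by
      funext s
      by_cases ha : a ∈ s
      · simp only [totalMap_apply, insertAt, if_pos ha, Pi.smul_apply, smul_smul]
        rw [Finset.mul_prod_erase s (fun i => x i ^ (m - m₁)) ha]
      · simp [totalMap_apply, insertAt, ha]
    -- Replacing `e_a ∧ d w₁` by `d (e_a ∧ w₁)` costs the Leibniz term `x_a^m₁ w₁` up to sign, which
    -- no longer involves `e_a`.
    have hfin : totalMap M x m m₁ z = totalMap M x m m₁ z₀ - x a ^ m₁ • signed M w₁ +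
        totalD M (fun i => x i ^ m₁) (insertAt M a w₁) := by
      rw [totalD_insertAt _ a hw₁.2, hdw₁, ← hins]
      conv_lhs => rw [hdec, map_add]
      abel
    obtain ⟨w₀, hw₀⟩ := h₁ m₁ le_rfl (totalMap M x m m₁ z₀ - x a ^ m₁ • signed M w₁)
      (Submodule.sub_mem _ hmap₀ (Submodule.smul_mem _ _ (hneg _ hw₁))) (by
        rw [map_sub, map_smul, totalD_signed, hdw₁, totalD_totalMap M x hm₁, hd₀, map_neg,
          map_smul, hsm, hsg, smul_neg, smul_smul, ← pow_add, Nat.add_sub_cancel' hm₁]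
        abel)
    refine ⟨w₀ + totalMap M x m₁ n (insertAt M a w₁), ?_⟩
    rw [map_add, ← hw₀, totalD_totalMap M x hn, ← map_add, ← hfin,
      totalMap_totalMap M x hn hm₁]

theorem isWeaklyProregular_of_isNoetherian [IsNoetherian R M] (x : Fin l → R) :
    IsWeaklyProregular x M := by
  intro n
  obtain ⟨m, hm, h⟩ := exists_totalD_eq_totalMap (M := M) x l le_rfl n
  refine ⟨m, hm, fun i hi => ?_⟩
  obtain ⟨p, rfl⟩ := Nat.exists_eq_add_of_le' hi
  refine LinearMap.ext fun c => ?_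
  obtain ⟨⟨z, hz⟩, rfl⟩ := Submodule.Quotient.mk_surjective _ c
  have hz' : koszulD (fun i => x i ^ m) M p z = 0 := hz
  have hD : ∀ {q : ℕ} (y : Fin l → R) (f : KoszulTerm M l (q + 1)) (F : Finset (Fin l) → M)
      (s : Idx l q), (∀ t : Idx l (q + 1), F t.1 = f t) → totalD M y F s.1 = koszulD y M q f s := by
    intro q y f F s hF
    rw [totalD_apply, koszulD_apply]
    rw [Finset.sum_subtype (p := fun i => i ∉ s.1) _ (fun i => Finset.mem_compl)]
    exact Finset.sum_congr rfl fun i _ => by rw [← hF]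
  let Z : Finset (Fin l) → M := fun s => if hs : s.card = p + 1 then z ⟨s, hs⟩ else 0
  have hZ : ∀ t : Idx l (p + 1), Z t.1 = z t := fun t => dif_pos t.2
  obtain ⟨w, hw⟩ := h m le_rfl Z
    ⟨dif_neg (by simp), fun s ⟨i, _, hi⟩ => absurd i.2 (not_lt.2 hi)⟩ (by
      funext s
      by_cases hs : s.card = p
      · rw [hD _ z Z ⟨s, hs⟩ hZ, hz']
        rfl
      · rw [totalD_apply]
        refine Finset.sum_eq_zero fun i hi => ?_
        rw [show Z (insert i s) = 0 from dif_neg ?_, smul_zero]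
        rw [Finset.card_insert_of_notMem (Finset.mem_compl.1 hi)]
        omega)
  refine (Submodule.Quotient.mk_eq_zero _).2 ⟨fun t => w t.1, funext fun s => ?_⟩
  rw [← hD _ _ w s fun t => rfl, ← hw, totalMap_apply, hZ]
  rfl

end TotalKoszul

/-! ### Čech cohomology is torsion with respect to each `x_j`. -/

section Torsion

variable {R : Type*} [CommRing R] {l : ℕ} (x : Fin l → R) {M : Type*} [AddCommGroup M] [Module R M]

theorem exists_pow_smul_eq_zero_of_cechRes_eq_zero {s t : Finset (Fin l)} (h : s ⊆ t) (j : Fin l)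
    (hj : t \ s = {j}) {w : CechLoc x M s} (hw : cechRes x M h w = 0) : ∃ k, x j ^ k • w = 0 := by
  obtain ⟨n, hn⟩ := exists_cechFrac_eq x M w
  obtain ⟨m, rfl⟩ := hn n le_rfl
  rw [cechRes_cechFrac, cechFrac_eq_zero_iff] at hw
  obtain ⟨k, hk⟩ := hw
  refine ⟨k + n, ?_⟩
  rw [← map_smul, cechFrac_eq_zero_iff]
  refine ⟨k, ?_⟩
  rw [← Finset.prod_sdiff h, hj, Finset.prod_singleton, mul_pow] at hk
  rw [← hk, smul_smul, smul_smul, pow_add]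
  congr 1
  ring

theorem sgn_smul_eq_zero_iff {N : Type*} [AddCommGroup N] [Module R N] (s : Finset (Fin l))
    (j : Fin l) {w : N} : (sgn s j : R) • w = 0 ↔ w = 0 := by
  refine ⟨fun h => ?_, fun h => by rw [h, smul_zero]⟩
  rw [← one_smul R w, ← sgn_mul_self s j, mul_smul, h, smul_zero]

/-- If `j ∉ t`, the only contribution to the differential at `t ∪ {j}` is the image of `y t` up to
sign. It vanishes after inverting `x j`, hence a power of `x j` kills `y t`. -/
theorem exists_pow_smul_eq_zero_of_cechD_eq_zero {p : ℕ} (j : Fin l) {y : CechTerm x M p}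
    (hy : cechD x M p y = 0) (h0 : ∀ t : Idx l p, j ∈ t.1 → y t = 0) : ∃ k, x j ^ k • y = 0 := by
  have key : ∀ t : Idx l p, ∃ k, x j ^ k • y t = 0 := by
    intro t
    by_cases hj : j ∈ t.1
    · exact ⟨0, by rw [h0 t hj, smul_zero]⟩
    · have hd : insert j t.1 \ t.1 = {j} := by
        ext i
        simp only [Finset.mem_sdiff, Finset.mem_insert, Finset.mem_singleton]
        constructor
        · rintro ⟨h | h, h'⟩
          · exact h
          · exact absurd h h'
        · rintro rfl
          exact ⟨Or.inl rfl, hj⟩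
      refine exists_pow_smul_eq_zero_of_cechRes_eq_zero x (Finset.subset_insert j t.1) j hd ?_
      have hc : ((insert j t.1).erase j).card = p := by rw [Finset.erase_insert hj, t.2]
      have h1 : cechRes x M (Finset.erase_subset j (insert j t.1)) (y ⟨_, hc⟩) = 0 := by
        have h2 := congrFun hy ⟨insert j t.1, by rw [Finset.card_insert_of_notMem hj, t.2]⟩
        rw [cechD_apply, Fintype.sum_eq_single ⟨j, Finset.mem_insert_self _ _⟩] at h2
        · exact (sgn_smul_eq_zero_iff _ _).1 h2
        · intro i hi
          rw [h0 _ (Finset.mem_erase.2 ⟨fun h => hi (Subtype.ext h.symm), by simp⟩), map_zero,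
            smul_zero]
      have aux : ∀ (s : Idx l p) (hs : s.1 ⊆ insert j t.1), s = t →
          cechRes x M hs (y s) = 0 → cechRes x M (Finset.subset_insert j t.1) (y t) = 0 := by
        rintro s hs rfl h
        exact h
      exact aux ⟨_, hc⟩ _ (Subtype.ext (Finset.erase_insert hj)) h1
  choose k hk using key
  refine ⟨Finset.univ.sup k, funext fun t => ?_⟩
  obtain ⟨d, hd⟩ := Nat.exists_eq_add_of_le (Finset.le_sup (f := k) (Finset.mem_univ t))
  change x j ^ _ • y t = 0
  rw [hd, pow_add, mul_comm, mul_smul, hk, smul_zero]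

/-- The Čech complex becomes contractible once `x j` is inverted. The cochain `c` is the contraction
of `m`, multiplied by `x_j^a` so that no denominator `x j` remains; then `x_j^a m - d c` is a
cocycle with zero components at all `t ∋ j`. -/
theorem exists_pow_smul_mem_boundaries (p : ℕ) (j : Fin l) {m : CechTerm x M p}
    (hm : cechD x M p m = 0) : ∃ k, x j ^ k • m ∈ cechBoundaries x M p := by
  cases p with
  | zero =>
    obtain ⟨k, hk⟩ := exists_pow_smul_eq_zero_of_cechD_eq_zero x j hm fun t ht => by
      rw [Finset.card_eq_zero.1 t.2] at ht
      simp at ht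
    exact ⟨k, hk ▸ zero_mem _⟩
  | succ q =>
    have hc : ∃ (a : ℕ) (c : CechTerm x M q), (∀ s, j ∈ s.1 → c s = 0) ∧
        ∀ (s : Idx l q) (t : Idx l (q + 1)) (hst : s.1 ⊆ t.1), j ∉ s.1 → t.1 = insert j s.1 →
          cechRes x M hst (c s) = x j ^ a • (sgn t.1 j : R) • m t := by
      obtain ⟨a, ha⟩ := exists_cechFrac_eq_forall x M (fun t : Idx l (q + 1) => t.1) m
      choose b hb using ha a le_rfl
      refine ⟨a, fun s => if hs : j ∈ s.1 then 0 else cechFrac x M s.1 a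
        ((sgn (insert j s.1) j : R) •
          b ⟨insert j s.1, by rw [Finset.card_insert_of_notMem hs, s.2]⟩),
        fun s hs => dif_pos hs, ?_⟩
      rintro s ⟨t, ht⟩ hst hs rfl
      have hd : insert j s.1 \ s.1 = {j} := by
        rw [Finset.insert_sdiff_of_notMem _ hs]
        simp
      simp only [dif_neg hs]
      rw [cechRes_cechFrac, hd, Finset.prod_singleton, ← hb, map_smul, map_smul]
    obtain ⟨a, c, hc0, hc⟩ := hc
    have hy : cechD x M (q + 1) (x j ^ a • m - cechD x M q c) = 0 := by
      rw [map_sub, map_smul, hm, smul_zero, cechD_cechD, sub_zero]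
    obtain ⟨k, hk⟩ := exists_pow_smul_eq_zero_of_cechD_eq_zero x j hy (by
      intro t ht
      change x j ^ a • m t - cechD x M q c t = 0
      rw [cechD_apply, Fintype.sum_eq_single ⟨j, ht⟩]
      · have hcard : (t.1.erase j).card = q := by
          rw [Finset.card_erase_of_mem ht, t.2, Nat.add_sub_cancel]
        have h1 := hc ⟨_, hcard⟩ t (Finset.erase_subset j t.1) (Finset.notMem_erase j t.1)
          (Finset.insert_erase ht).symm
        change x j ^ a • m t -
          (sgn t.1 j : R) • cechRes x M (Finset.erase_subset j t.1) (c ⟨_, hcard⟩) = 0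
        rw [h1, smul_comm (sgn t.1 j : R) (x j ^ a), smul_smul (sgn t.1 j : R), sgn_mul_self,
          one_smul, sub_self]
      · intro i hi
        rw [hc0 _ (Finset.mem_erase.2 ⟨fun h => hi (Subtype.ext h.symm), ht⟩), map_zero,
          smul_zero])
    refine ⟨k + a, x j ^ k • c, ?_⟩
    rw [smul_sub, sub_eq_zero, smul_smul, ← pow_add] at hk
    rw [map_smul, hk]

theorem exists_pow_smul_cechCohomology_eq_zero (p : ℕ) (j : Fin l) (c : CechCohomology x M p) :
    ∃ k, x j ^ k • c = 0 := by
  obtain ⟨⟨c, hc⟩, rfl⟩ := Submodule.Quotient.mk_surjective _ c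
  obtain ⟨k, hk⟩ := exists_pow_smul_mem_boundaries x p j hc
  exact ⟨k, (Submodule.Quotient.mk_eq_zero _).2 hk⟩

end Torsion

/-! ### Functoriality and the long exact sequence. -/

section Functoriality

variable {R : Type*} [CommRing R] {l : ℕ} (x : Fin l → R)
  {M : Type*} [AddCommGroup M] [Module R M] {N : Type*} [AddCommGroup N] [Module R N]
  {P : Type*} [AddCommGroup P] [Module R P]

/-- The map induced on localizations. -/
noncomputable def cechLocMap (s : Finset (Fin l)) (f : M →ₗ[R] N) :
    CechLoc x M s →ₗ[R] CechLoc x N s :=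
  IsLocalizedModule.map (Submonoid.powers (∏ i ∈ s, x i)) (LocalizedModule.mkLinearMap _ M)
    (LocalizedModule.mkLinearMap _ N) f

theorem cechLocMap_cechFrac (s : Finset (Fin l)) (f : M →ₗ[R] N) (n : ℕ) (m : M) :
    cechLocMap x s f (cechFrac x M s n m) = cechFrac x N s n (f m) :=
  IsLocalizedModule.map_LocalizedModules _ _ _ _

theorem cechLocMap_cechRes {s t : Finset (Fin l)} (h : s ⊆ t) (f : M →ₗ[R] N) (w : CechLoc x M s) :
    cechLocMap x t f (cechRes x M h w) = cechRes x N h (cechLocMap x s f w) := by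
  obtain ⟨n, hn⟩ := exists_cechFrac_eq x M w
  obtain ⟨m, rfl⟩ := hn n le_rfl
  simp only [cechRes_cechFrac, cechLocMap_cechFrac, map_smul]

/-- The map of Čech complexes induced by a linear map, in degree `p`. -/
noncomputable def cechMap (f : M →ₗ[R] N) (p : ℕ) : CechTerm x M p →ₗ[R] CechTerm x N p :=
  LinearMap.pi fun s => (cechLocMap x s.1 f).comp (LinearMap.proj s)

theorem cechMap_apply (f : M →ₗ[R] N) (p : ℕ) (m : CechTerm x M p) (s : Idx l p) :
    cechMap x f p m s = cechLocMap x s.1 f (m s) := rfl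

theorem cechD_cechMap (f : M →ₗ[R] N) (p : ℕ) (m : CechTerm x M p) :
    cechD x N p (cechMap x f p m) = cechMap x f (p + 1) (cechD x M p m) := by
  funext t
  simp only [cechD_apply, cechMap_apply, map_sum, map_smul, cechLocMap_cechRes]

theorem cechMap_injective {f : M →ₗ[R] N} (hf : Function.Injective f) (p : ℕ) :
    Function.Injective (cechMap x f p) := fun _ _ h =>
  funext fun s => IsLocalizedModule.map_injective (Submonoid.powers (∏ i ∈ s.1, x i)) _ _ f hf
    (congrFun h s)

theorem cechMap_surjective {f : M →ₗ[R] N} (hf : Function.Surjective f) (p : ℕ) :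
    Function.Surjective (cechMap x f p) := by
  intro y
  have key : ∀ s : Idx l p, ∃ w, cechLocMap x s.1 f w = y s := fun s =>
    IsLocalizedModule.map_surjective (Submonoid.powers (∏ i ∈ s.1, x i)) _ _ f hf (y s)
  choose z hz using key
  exact ⟨z, funext hz⟩

theorem cechMap_exact {f : M →ₗ[R] N} {g : N →ₗ[R] P} (h : Function.Exact f g) (p : ℕ) :
    Function.Exact (cechMap x f p) (cechMap x g p) := by
  have hs := fun s : Idx l p => LocalizedModule.map_exact (Submonoid.powers (∏ i ∈ s.1, x i)) f g h
  intro y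
  constructor
  · intro hy
    choose z hz using fun s : Idx l p => (hs s (y s)).1 (congrFun hy s)
    exact ⟨z, funext hz⟩
  · rintro ⟨z, rfl⟩
    exact funext fun s => (hs s _).2 ⟨z s, rfl⟩

theorem cechMap_comp (f : M →ₗ[R] N) (g : N →ₗ[R] P) (p : ℕ) (m : CechTerm x M p) :
    cechMap x (g.comp f) p m = cechMap x g p (cechMap x f p m) := by
  funext s
  simp only [cechMap_apply]
  obtain ⟨n, hn⟩ := exists_cechFrac_eq x M (m s)
  obtain ⟨m, hm⟩ := hn n le_rfl
  simp only [← hm, cechLocMap_cechFrac, LinearMap.comp_apply]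

theorem cechMap_smul_id (r : R) (p : ℕ) (m : CechTerm x M p) :
    cechMap x (r • LinearMap.id) p m = r • m := by
  funext s
  change cechLocMap x s.1 _ (m s) = r • m s
  obtain ⟨n, hn⟩ := exists_cechFrac_eq x M (m s)
  obtain ⟨m, hm⟩ := hn n le_rfl
  simp only [← hm, cechLocMap_cechFrac, LinearMap.smul_apply, LinearMap.id_apply, map_smul]

theorem cechMap_mem_boundaries (f : M →ₗ[R] N) (p : ℕ) {m : CechTerm x M p}
    (hm : m ∈ cechBoundaries x M p) : cechMap x f p m ∈ cechBoundaries x N p := by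
  cases p with
  | zero =>
    rw [show m = 0 from hm, map_zero]
    exact zero_mem _
  | succ p =>
    obtain ⟨b, rfl⟩ := hm
    exact ⟨cechMap x f p b, cechD_cechMap x f p b⟩

theorem exists_mem_boundaries_cechMap_eq {f : M →ₗ[R] N} (hf : Function.Surjective f) (p : ℕ)
    {y : CechTerm x N p} (hy : y ∈ cechBoundaries x N p) :
    ∃ m ∈ cechBoundaries x M p, cechMap x f p m = y := by
  cases p with
  | zero => exact ⟨0, zero_mem _, by rw [map_zero, show y = 0 from hy]⟩
  | succ p =>
    obtain ⟨b, rfl⟩ := hy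
    obtain ⟨c, rfl⟩ := cechMap_surjective x hf p b
    exact ⟨_, ⟨c, rfl⟩, (cechD_cechMap x f p c).symm⟩

theorem cechD_eq_zero_of_mem_boundaries (p : ℕ) {m : CechTerm x M p}
    (hm : m ∈ cechBoundaries x M p) : cechD x M p m = 0 := by
  cases p with
  | zero => rw [show m = 0 from hm, map_zero]
  | succ p =>
    obtain ⟨b, rfl⟩ := hm
    exact cechD_cechD x M p b

/-- The class of a cocycle. -/
noncomputable def cechClass (M : Type*) [AddCommGroup M] [Module R M] (p : ℕ) :
    LinearMap.ker (cechD x M p) →ₗ[R] CechCohomology x M p := Submodule.mkQ _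

theorem cechClass_surjective (M : Type*) [AddCommGroup M] [Module R M] (p : ℕ) :
    Function.Surjective (cechClass x M p) := Submodule.mkQ_surjective _

theorem cechClass_eq_zero_iff {p : ℕ} {z : LinearMap.ker (cechD x M p)} :
    cechClass x M p z = 0 ↔ z.1 ∈ cechBoundaries x M p := Submodule.Quotient.mk_eq_zero _

/-- The map induced on cocycles. -/
noncomputable def cechCocycleMap (f : M →ₗ[R] N) (p : ℕ) :
    LinearMap.ker (cechD x M p) →ₗ[R] LinearMap.ker (cechD x N p) :=
  (cechMap x f p).restrict fun m hm => by
    rw [LinearMap.mem_ker] at hm ⊢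
    rw [cechD_cechMap, hm, map_zero]

/-- The map induced on Čech cohomology. -/
noncomputable def cechCohomologyMap (f : M →ₗ[R] N) (p : ℕ) :
    CechCohomology x M p →ₗ[R] CechCohomology x N p :=
  Submodule.mapQ _ _ (cechCocycleMap x f p) fun _ hm => cechMap_mem_boundaries x f p hm

theorem cechCohomologyMap_cechClass (f : M →ₗ[R] N) (p : ℕ) (z : LinearMap.ker (cechD x M p)) :
    cechCohomologyMap x f p (cechClass x M p z) = cechClass x N p (cechCocycleMap x f p z) := rfl

theorem cechCohomologyMap_comp (f : M →ₗ[R] N) (g : N →ₗ[R] P) (p : ℕ) (c : CechCohomology x M p) :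
    cechCohomologyMap x (g.comp f) p c = cechCohomologyMap x g p (cechCohomologyMap x f p c) := by
  obtain ⟨z, rfl⟩ := cechClass_surjective x M p c
  simp only [cechCohomologyMap_cechClass]
  congr 1
  exact Subtype.ext (cechMap_comp x f g p z.1)

theorem cechCohomologyMap_smul_id (r : R) (p : ℕ) (c : CechCohomology x M p) :
    cechCohomologyMap x (r • LinearMap.id) p c = r • c := by
  obtain ⟨z, rfl⟩ := cechClass_surjective x M p c
  rw [cechCohomologyMap_cechClass, ← map_smul]
  congr 1
  exact Subtype.ext (cechMap_smul_id x r p z.1)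

theorem cechCohomologyMap_zero (p : ℕ) (c : CechCohomology x M p) :
    cechCohomologyMap x (0 : M →ₗ[R] N) p c = 0 := by
  have : (0 : M →ₗ[R] N) = ((0 : R) • LinearMap.id).comp (0 : M →ₗ[R] N) := by simp
  rw [this, cechCohomologyMap_comp, cechCohomologyMap_smul_id, zero_smul]

variable {f : M →ₗ[R] N} {g : N →ₗ[R] P}

theorem cechCohomologyMap_exact (hf : Function.Injective f) (hg : Function.Surjective g)
    (h : Function.Exact f g) (p : ℕ) :
    Function.Exact (cechCohomologyMap x f p) (cechCohomologyMap x g p) := by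
  intro c
  constructor
  · intro hc
    obtain ⟨z, rfl⟩ := cechClass_surjective x N p c
    rw [cechCohomologyMap_cechClass, cechClass_eq_zero_iff] at hc
    obtain ⟨b, hb, hbz⟩ := exists_mem_boundaries_cechMap_eq x hg p hc
    obtain ⟨a, ha⟩ := (cechMap_exact x h p (z.1 - b)).1 (by
      rw [map_sub, hbz, sub_eq_zero]; rfl)
    have hda : cechD x M p a = 0 := by
      apply cechMap_injective x hf (p + 1)
      rw [← cechD_cechMap, ha, map_sub, z.2, cechD_eq_zero_of_mem_boundaries x p hb, map_zero,
        sub_zero]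
    refine ⟨cechClass x M p ⟨a, hda⟩, ?_⟩
    rw [cechCohomologyMap_cechClass, ← sub_eq_zero, ← map_sub, cechClass_eq_zero_iff]
    change cechMap x f p a - z.1 ∈ _
    rw [ha, sub_sub_cancel_left]
    exact neg_mem hb
  · rintro ⟨c, rfl⟩
    rw [← cechCohomologyMap_comp, h.linearMap_comp_eq_zero, cechCohomologyMap_zero]

theorem cechCohomologyMap_surjective (hf : Function.Injective f) (hg : Function.Surjective g)
    (h : Function.Exact f g) (p : ℕ) [Subsingleton (CechCohomology x M (p + 1))] :
    Function.Surjective (cechCohomologyMap x g p) := by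
  intro c
  obtain ⟨z, rfl⟩ := cechClass_surjective x P p c
  obtain ⟨y, hy⟩ := cechMap_surjective x hg p z.1
  obtain ⟨a, ha⟩ := (cechMap_exact x h (p + 1) (cechD x N p y)).1 (by
    rw [← cechD_cechMap, hy, z.2])
  have hda : cechD x M (p + 1) a = 0 := by
    apply cechMap_injective x hf (p + 2)
    rw [← cechD_cechMap, ha, cechD_cechD, map_zero]
  obtain ⟨b, hb⟩ := (cechClass_eq_zero_iff x).1
    (Subsingleton.elim (cechClass x M (p + 1) ⟨a, hda⟩) 0)
  refine ⟨cechClass x N p ⟨y - cechMap x f p b, ?_⟩, ?_⟩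
  · rw [LinearMap.mem_ker, map_sub, cechD_cechMap, hb, ha, sub_self]
  · rw [cechCohomologyMap_cechClass]
    congr 1
    refine Subtype.ext ?_
    change cechMap x g p (y - cechMap x f p b) = z.1
    rw [map_sub, hy, (cechMap_exact x h p _).2 ⟨b, rfl⟩, sub_zero]

/-- The connecting relation between `H^p(P)` and `H^{p+1}(M)`, for a short exact sequence
`0 → M → N → P → 0`. -/
theorem exists_connecting (hf : Function.Injective f) (hg : Function.Surjective g)
    (h : Function.Exact f g) (p : ℕ) :
    ∃ (W : Submodule R (CechTerm x N p)) (a : W →ₗ[R] CechCohomology x P p)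
      (b : W →ₗ[R] CechCohomology x M (p + 1)), LinearMap.ker a ≤ LinearMap.ker b ∧
        LinearMap.range b = LinearMap.ker (cechCohomologyMap x f (p + 1)) := by
  let Z := LinearMap.ker (cechD x M (p + 1))
  let F : Z →ₗ[R] CechTerm x N (p + 1) := (cechMap x f (p + 1)).comp Z.subtype
  have hF : Function.Injective F :=
    (cechMap_injective x hf (p + 1)).comp Subtype.val_injective
  -- `W` consists of the cochains of `N` whose differential comes from a cocycle of `M`. Using it in
  -- place of `H^p(P)` avoids choosing lifts: `ker a ≤ ker b` exhibits the kernel of `H^(p+1)(M) →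
  -- H^(p+1)(N)` as a quotient of the submodule `range a` of `H^p(P)`.
  let W := (LinearMap.range F).comap (cechD x N p)
  let e : W →ₗ[R] Z := (LinearEquiv.ofInjective F hF).symm.toLinearMap.comp
    ((cechD x N p).restrict (p := W) (q := LinearMap.range F) fun _ hw => hw)
  have he : ∀ w : W, cechMap x f (p + 1) (e w).1 = cechD x N p w.1 := fun w =>
    congrArg Subtype.val ((LinearEquiv.ofInjective F hF).apply_symm_apply
      ((cechD x N p).restrict (p := W) (q := LinearMap.range F) (fun _ hw => hw) w))
  let G : W →ₗ[R] LinearMap.ker (cechD x P p) :=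
    (cechMap x g p).restrict fun w hw => by
      rw [LinearMap.mem_ker, cechD_cechMap]
      exact (cechMap_exact x h (p + 1) _).2 ⟨_, he ⟨w, hw⟩⟩
  refine ⟨W, (cechClass x P p).comp G, (cechClass x M (p + 1)).comp e, ?_, ?_⟩
  · intro w hw
    have hw' : cechMap x g p w.1 ∈ cechBoundaries x P p := (cechClass_eq_zero_iff x).1 hw
    obtain ⟨b, hb, hbw⟩ := exists_mem_boundaries_cechMap_eq x hg p hw'
    obtain ⟨a, ha⟩ := (cechMap_exact x h p (w.1 - b)).1 (by rw [map_sub, hbw, sub_self])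
    refine (cechClass_eq_zero_iff x).2 ⟨a, ?_⟩
    apply cechMap_injective x hf (p + 1)
    rw [← cechD_cechMap, ha, map_sub, he, cechD_eq_zero_of_mem_boundaries x p hb, sub_zero]
  · ext c
    constructor
    · rintro ⟨w, rfl⟩
      exact (cechClass_eq_zero_iff x).2 ⟨w.1, (he w).symm⟩
    · intro hc
      obtain ⟨z, rfl⟩ := cechClass_surjective x M (p + 1) c
      obtain ⟨w, hw⟩ := (cechClass_eq_zero_iff x).1 hc
      refine ⟨⟨w, ⟨z, hw.symm⟩⟩, congrArg (cechClass x M (p + 1)) ?_⟩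
      apply hF
      exact (he ⟨w, ⟨z, hw.symm⟩⟩).trans hw

end Functoriality

/-! ### Criteria for vanishing and for the Artinian property. -/

section Vanishing

variable {R : Type*} [CommRing R] {l : ℕ} (x : Fin l → R)
  {M : Type*} [AddCommGroup M] [Module R M] {N : Type*} [AddCommGroup N] [Module R N]

theorem subsingleton_cechCohomology_of_term {p : ℕ} [Subsingleton (CechTerm x M p)] :
    Subsingleton (CechCohomology x M p) := by
  refine ⟨fun a b => ?_⟩
  obtain ⟨a, rfl⟩ := cechClass_surjective x M p a
  obtain ⟨b, rfl⟩ := cechClass_surjective x M p b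
  exact congrArg _ (Subtype.ext (Subsingleton.elim _ _))

theorem subsingleton_cechCohomology_of_subsingleton [Subsingleton M] (p : ℕ) :
    Subsingleton (CechCohomology x M p) := by
  have : Subsingleton (CechTerm x M p) := by
    refine subsingleton_of_forall_eq 0 fun c => funext fun s => ?_
    obtain ⟨n, hn⟩ := exists_cechFrac_eq x M (c s)
    obtain ⟨m, hm⟩ := hn n le_rfl
    rw [← hm, Subsingleton.elim m 0, map_zero]
    rfl
  exact subsingleton_cechCohomology_of_term x

theorem subsingleton_cechTerm_succ_of_smul_eq_zero (h : ∀ j (m : M), x j • m = 0) (p : ℕ) :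
    Subsingleton (CechTerm x M (p + 1)) := by
  refine subsingleton_of_forall_eq 0 fun c => funext fun s => ?_
  obtain ⟨n, hn⟩ := exists_cechFrac_eq x M (c s)
  obtain ⟨m, hm⟩ := hn n le_rfl
  rw [← hm]
  refine (cechFrac_eq_zero_iff x M).2 ⟨1, ?_⟩
  obtain ⟨j, hj⟩ := Finset.card_pos.1 (by rw [s.2]; exact Nat.succ_pos p)
  rw [pow_one, ← Finset.prod_erase_mul _ _ hj, mul_smul, h, smul_zero]

theorem cechFrac_empty_bijective :
    Function.Bijective (cechFrac x M (∅ : Finset (Fin l)) 0) := by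
  constructor
  · refine (injective_iff_map_eq_zero _).2 fun m hm => ?_
    obtain ⟨k, hk⟩ := (cechFrac_eq_zero_iff x M).1 hm
    simpa using hk
  · intro w
    obtain ⟨n, hn⟩ := exists_cechFrac_eq x M w
    obtain ⟨m, rfl⟩ := hn n le_rfl
    exact ⟨m, by simpa using (cechFrac_add x M 0 n m (s := ∅)).symm⟩

/-- The degree zero term of the Čech complex. -/
noncomputable def cechZero (M : Type*) [AddCommGroup M] [Module R M] :
    M →ₗ[R] CechTerm x M 0 :=
  LinearMap.pi fun s => cechFrac x M s.1 0

theorem cechZero_bijective : Function.Bijective (cechZero x M) := by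
  have hs : ∀ s : Idx l 0, s = ⟨∅, rfl⟩ := fun s => Subtype.ext (Finset.card_eq_zero.1 s.2)
  constructor
  · intro a b h
    exact (cechFrac_empty_bijective x).1 (congrFun h ⟨∅, rfl⟩)
  · intro c
    obtain ⟨m, hm⟩ := (cechFrac_empty_bijective x).2 (c ⟨∅, rfl⟩)
    refine ⟨m, funext fun s => ?_⟩
    obtain rfl := hs s
    exact hm

theorem isArtinian_cechCohomology_zero [IsArtinian R M] : IsArtinian R (CechCohomology x M 0) := by
  have : IsArtinian R (CechTerm x M 0) :=
    isArtinian_of_surjective _ (cechZero x M) (cechZero_bijective x).2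
  exact isArtinian_of_surjective _ (cechClass x M 0) (cechClass_surjective x M 0)

theorem nontrivial_cechCohomology_zero [Nontrivial M] (h : ∀ j (m : M), x j • m = 0) :
    Nontrivial (CechCohomology x M 0) := by
  have := subsingleton_cechTerm_succ_of_smul_eq_zero x h 0
  obtain ⟨m, hm⟩ := exists_ne (0 : M)
  refine ⟨cechClass x M 0 ⟨cechZero x M m, Subsingleton.elim _ _⟩, 0, fun h0 => hm ?_⟩
  apply (cechZero_bijective x).1
  rw [map_zero]
  exact (cechClass_eq_zero_iff x).1 h0

theorem cechCohomologyMap_zero_injective {f : M →ₗ[R] N} (hf : Function.Injective f) :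
    Function.Injective (cechCohomologyMap x f 0) := by
  refine (injective_iff_map_eq_zero _).2 fun c hc => ?_
  obtain ⟨z, rfl⟩ := cechClass_surjective x M 0 c
  rw [cechCohomologyMap_cechClass, cechClass_eq_zero_iff] at hc
  have h0 : cechMap x f 0 z.1 = 0 := hc
  refine (cechClass_eq_zero_iff x).2 ?_
  rw [cechMap_injective x hf 0 (h0.trans (map_zero _).symm)]
  exact zero_mem _

/-- Multiplication by `x j` is locally nilpotent on Čech cohomology, so it can be injective only on
zero. -/
theorem subsingleton_cechCohomology_of_cechCohomologyMap_injective {j : Fin l} {p : ℕ}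
    (h : Function.Injective (cechCohomologyMap x (x j • LinearMap.id : M →ₗ[R] M) p)) :
    Subsingleton (CechCohomology x M p) := by
  refine subsingleton_of_forall_eq 0 fun c => ?_
  obtain ⟨k, hk⟩ := exists_pow_smul_cechCohomology_eq_zero x p j c
  induction k with
  | zero => simpa using hk
  | succ k ih =>
    refine ih (h ?_)
    rw [cechCohomologyMap_smul_id, map_zero, smul_smul, ← pow_succ', hk]

theorem subsingleton_cechCohomology_zero_of_injective {j : Fin l}
    (h : Function.Injective (x j • LinearMap.id : M →ₗ[R] M)) :
    Subsingleton (CechCohomology x M 0) :=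
  subsingleton_cechCohomology_of_cechCohomologyMap_injective x
    (cechCohomologyMap_zero_injective x h)

theorem subsingleton_cechCohomology_succ_of_injective {j : Fin l} {p : ℕ}
    (h : Function.Injective (x j • LinearMap.id : M →ₗ[R] M))
    [Subsingleton (CechCohomology x (M ⧸ LinearMap.range (x j • LinearMap.id : M →ₗ[R] M)) p)] :
    Subsingleton (CechCohomology x M (p + 1)) := by
  refine subsingleton_cechCohomology_of_cechCohomologyMap_injective x (j := j) ?_
  obtain ⟨W, a, b, hab, hb⟩ := exists_connecting x h (Submodule.mkQ_surjective _)
    (LinearMap.exact_map_mkQ_range _) p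
  rw [← LinearMap.ker_eq_bot, ← hb, LinearMap.range_eq_bot, ← LinearMap.ker_eq_top, eq_top_iff]
  exact fun w _ => hab (Subsingleton.elim _ _)

/-- For a descending chain `f`, let `U n k` be the part of `y^n f_k` killed by `y`. These submodules
of an Artinian module decrease in both indices, so they stabilize in `k` uniformly in `n`. Equality
of the `U n k` then gives equality of the chain, by induction on the power of `y` killing an
element. -/
theorem isArtinian_of_pow_smul_eq_zero (y : R) (h : ∀ m : M, ∃ k, y ^ k • m = 0)
    [IsArtinian R (LinearMap.ker (y • LinearMap.id : M →ₗ[R] M))] : IsArtinian R M := by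
  rw [← monotone_stabilizes_iff_artinian]
  intro f
  have hf : ∀ {a b}, a ≤ b → (f b).ofDual ≤ (f a).ofDual := fun hab => f.monotone hab
  let K := LinearMap.ker (y • LinearMap.id : M →ₗ[R] M)
  let U : ℕ → ℕ → Submodule R K := fun n k =>
    ((f k).ofDual.map (LinearMap.lsmul R M (y ^ n))).comap K.subtype
  have hU : ∀ {n n' k k'}, n ≤ n' → k ≤ k' → U n' k' ≤ U n k := by
    rintro n n' k k' hn hk c ⟨d, hd, hdc⟩
    refine ⟨y ^ (n' - n) • d, hf hk (Submodule.smul_mem _ _ hd), ?_⟩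
    rw [← hdc, LinearMap.lsmul_apply, LinearMap.lsmul_apply, smul_smul, ← pow_add,
      Nat.add_sub_cancel' hn]
  have hstab : ∀ g : ℕ → Submodule R K, Antitone g → ∃ n, ∀ m, n ≤ m → g n = g m := fun g hg =>
    monotone_stabilizes_iff_artinian.2 ‹_› ⟨fun n => OrderDual.toDual (g n), fun _ _ hab => hg hab⟩
  obtain ⟨k₀, hk₀⟩ := hstab (fun k => U k k) fun a b hab => hU hab hab
  choose t ht using fun n => hstab (U n) fun a b hab => hU le_rfl hab
  -- The stable diagonal handles all rows `n ≥ k₀`; the finitely many rows below `k₀` are handled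
  -- individually.
  let T := max k₀ ((Finset.range k₀).sup t)
  have hT : ∀ n k, T ≤ k → U n T ≤ U n k := by
    intro n k hk
    by_cases hn : n < k₀
    · have h1 : t n ≤ T := (Finset.le_sup (Finset.mem_range.2 hn)).trans (le_max_right _ _)
      rw [← ht n T h1, ← ht n k (h1.trans hk)]
    · push Not at hn
      calc U n T ≤ U k₀ k₀ := hU hn (le_max_left _ _)
        _ = U (max n k) (max n k) := hk₀ _ (hn.trans (le_max_left _ _))
        _ ≤ U n k := hU (le_max_left _ _) (le_max_right _ _)
  refine ⟨T, fun k hk => ?_⟩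
  refine le_antisymm (f.monotone hk) ?_
  have key : ∀ e, ∀ d ∈ (f T).ofDual, y ^ e • d = 0 → d ∈ (f k).ofDual := by
    intro e
    induction e with
    | zero =>
      intro d _ hd
      rw [pow_zero, one_smul] at hd
      rw [hd]
      exact zero_mem _
    | succ e ih =>
      intro d hd hde
      have hK : y ^ e • d ∈ K := by
        rw [LinearMap.mem_ker, LinearMap.smul_apply, LinearMap.id_apply, smul_smul, ← pow_succ',
          hde]
      obtain ⟨d', hd', hdd'⟩ := hT e k hk (show (⟨_, hK⟩ : K) ∈ U e T from ⟨d, hd, rfl⟩)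
      have h1 : d - d' ∈ (f k).ofDual := ih (d - d') (sub_mem hd (hf hk hd')) (by
        rw [smul_sub, sub_eq_zero]
        exact hdd'.symm)
      simpa using add_mem h1 hd'
  intro d hd
  obtain ⟨e, he⟩ := h d
  exact key e d hd he

/-- The kernel of `x j` on `H^(p+1)(M)` is a subquotient of `H^p(M / x_j M)`, hence Artinian, and
`H^(p+1)(M)` is `x j`-power torsion. -/
theorem isArtinian_cechCohomology_succ_of_injective {j : Fin l} {p : ℕ}
    (h : Function.Injective (x j • LinearMap.id : M →ₗ[R] M))
    [IsArtinian R (CechCohomology x (M ⧸ LinearMap.range (x j • LinearMap.id : M →ₗ[R] M)) p)] :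
    IsArtinian R (CechCohomology x M (p + 1)) := by
  obtain ⟨W, a, b, hab, hb⟩ := exists_connecting x h (Submodule.mkQ_surjective _)
    (LinearMap.exact_map_mkQ_range _) p
  have h1 : IsArtinian R (LinearMap.range a) := inferInstance
  have h2 : IsArtinian R (W ⧸ LinearMap.ker a) :=
    isArtinian_of_linearEquiv a.quotKerEquivRange.symm
  have h3 : IsArtinian R (W ⧸ LinearMap.ker b) :=
    isArtinian_of_surjective _ (Submodule.factor hab) (Submodule.factor_surjective hab)
  have h4 : IsArtinian R (LinearMap.range b) := isArtinian_of_linearEquiv b.quotKerEquivRange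
  have h5 : cechCohomologyMap x (x j • LinearMap.id : M →ₗ[R] M) (p + 1) =
      x j • LinearMap.id := LinearMap.ext fun c => cechCohomologyMap_smul_id x _ _ c
  rw [hb, h5] at h4
  exact isArtinian_of_pow_smul_eq_zero (x j) (exists_pow_smul_cechCohomology_eq_zero x _ j)

theorem subsingleton_cechCohomology_of_equiv (e : M ≃ₗ[R] N) (p : ℕ)
    [Subsingleton (CechCohomology x N p)] : Subsingleton (CechCohomology x M p) := by
  refine subsingleton_of_forall_eq 0 fun c => ?_
  have h1 : (e.symm : N →ₗ[R] M).comp (e : M →ₗ[R] N) = (1 : R) • LinearMap.id := by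
    ext; simp
  rw [← one_smul R c, ← cechCohomologyMap_smul_id, ← h1, cechCohomologyMap_comp,
    Subsingleton.elim (cechCohomologyMap x (e : M →ₗ[R] N) p c) 0, map_zero]

theorem cechCohomologyMap_surjective_of_ker_of_range (f : M →ₗ[R] N) (p : ℕ)
    [Subsingleton (CechCohomology x (LinearMap.ker f) (p + 1))]
    [Subsingleton (CechCohomology x (N ⧸ LinearMap.range f) p)] :
    Function.Surjective (cechCohomologyMap x f p) := by
  have h1 : Function.Surjective (cechCohomologyMap x f.rangeRestrict p) := by
    refine cechCohomologyMap_surjective x (f := (LinearMap.ker f).subtype)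
      Subtype.val_injective f.surjective_rangeRestrict ?_ p
    rw [LinearMap.exact_iff, LinearMap.ker_rangeRestrict, Submodule.range_subtype]
  have h2 : Function.Surjective (cechCohomologyMap x (LinearMap.range f).subtype p) := fun c =>
    (cechCohomologyMap_exact x Subtype.val_injective (Submodule.mkQ_surjective _)
      (LinearMap.exact_subtype_mkQ _) p c).1 (Subsingleton.elim _ _)
  intro c
  obtain ⟨c, rfl⟩ := h2 c
  obtain ⟨c, rfl⟩ := h1 c
  refine ⟨c, ?_⟩
  rw [← cechCohomologyMap_comp]
  rfl

end Vanishing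

/-! ### Vanishing above the dimension and the Artinian property. -/

section Noetherian

variable {A : Type u} [CommRing A] {l : ℕ} (x : Fin l → A)

theorem smul_eq_zero_of_equiv_quotient {N : Type*} [AddCommGroup N] [Module A N] {p : Ideal A}
    (e : N ≃ₗ[A] A ⧸ p) {a : A} (ha : a ∈ p) (m : N) : a • m = 0 := by
  rw [← e.map_eq_zero_iff, map_smul]
  obtain ⟨b, hb⟩ := Ideal.Quotient.mk_surjective (e m)
  rw [← hb]
  exact Ideal.Quotient.eq_zero_iff_mem.2 (Ideal.mul_mem_right b _ ha)

theorem smul_id_injective_of_equiv_quotient {N : Type*} [AddCommGroup N] [Module A N]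
    {p : Ideal A} [hp : p.IsPrime] (e : N ≃ₗ[A] A ⧸ p) {a : A} (ha : a ∉ p) :
    Function.Injective (a • LinearMap.id : N →ₗ[A] N) := by
  refine (injective_iff_map_eq_zero _).2 fun n hn => ?_
  have h1 : a • e n = 0 := by
    rw [← map_smul]
    exact (congrArg e hn).trans (map_zero e)
  obtain ⟨b, hb⟩ := Ideal.Quotient.mk_surjective (e n)
  rw [← hb] at h1
  have h2 : a * b ∈ p := Ideal.Quotient.eq_zero_iff_mem.1 h1
  rw [← e.map_eq_zero_iff, ← hb]
  exact Ideal.Quotient.eq_zero_iff_mem.2 ((hp.mem_or_mem h2).resolve_left ha)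

theorem mem_support_of_mem_support_quotient_smul {N : Type*} [AddCommGroup N] [Module A N] (a : A)
    {P : PrimeSpectrum A}
    (hP : P ∈ Module.support A (N ⧸ LinearMap.range (a • LinearMap.id : N →ₗ[A] N))) :
    P ∈ Module.support A N ∧ a ∈ P.asIdeal := by
  refine ⟨Module.support_subset_of_surjective _ (Submodule.mkQ_surjective _) hP,
    Module.annihilator_le_of_mem_support hP (Module.mem_annihilator.2 fun c => ?_)⟩
  obtain ⟨n, rfl⟩ := Submodule.mkQ_surjective _ c
  rw [← map_smul]
  exact (Submodule.Quotient.mk_eq_zero _).2 ⟨n, rfl⟩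

theorem mem_support_iff_of_equiv_quotient {N : Type*} [AddCommGroup N] [Module A N]
    {p P : PrimeSpectrum A} (e : N ≃ₗ[A] A ⧸ p.asIdeal) :
    P ∈ Module.support A N ↔ p ≤ P := by
  have := Module.Finite.equiv e.symm
  rw [Module.mem_support_iff_of_finite, e.annihilator_eq, Ideal.annihilator_quotient]
  rfl

variable [IsNoetherianRing A]

/-- A prime filtration reduces to `A/p`; note that the coheight of `p` is `dim A/p`. Either all `x
j` lie in `p` and the Čech terms vanish in positive degree, or some `x j` is regular on `A/p` and
the quotient by it has smaller dimension. -/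
theorem subsingleton_cechCohomology_of_coheight_lt (i : ℕ) :
    ∀ (N : Type v) [AddCommGroup N] [Module A N] [Module.Finite A N],
      (∀ P ∈ Module.support A N, Order.coheight P < i) → Subsingleton (CechCohomology x N i) := by
  induction i with
  | zero =>
    intro N _ _ _ h
    have : Subsingleton N := Module.support_eq_empty_iff.1
      (Set.eq_empty_of_forall_notMem fun P hP => by simpa using h P hP)
    exact subsingleton_cechCohomology_of_subsingleton x 0
  | succ i ih =>
    intro N _ _ hN
    refine IsNoetherianRing.induction_on_isQuotientEquivQuotientPrime A hN
      (motive := fun N _ _ _ => (∀ P ∈ Module.support A N, Order.coheight P < (i + 1 : ℕ)) →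
        Subsingleton (CechCohomology x N (i + 1))) ?_ ?_ ?_
    · intro N _ _ _ _ _
      exact subsingleton_cechCohomology_of_subsingleton x _
    · intro N _ _ _ p e h
      by_cases hx : ∀ j, x j ∈ p.asIdeal
      · have := subsingleton_cechTerm_succ_of_smul_eq_zero x (M := N)
          (fun j => smul_eq_zero_of_equiv_quotient e (hx j)) i
        exact subsingleton_cechCohomology_of_term x
      · push Not at hx
        obtain ⟨j, hj⟩ := hx
        have hinj := smul_id_injective_of_equiv_quotient e hj
        have := ih (N ⧸ LinearMap.range (x j • LinearMap.id : N →ₗ[A] N)) fun P hP => by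
          obtain ⟨hP1, hP2⟩ := mem_support_of_mem_support_quotient_smul (x j) hP
          have hlt : p < P := lt_of_le_of_ne ((mem_support_iff_of_equiv_quotient e).1 hP1)
            fun h => hj (h ▸ hP2)
          have h1 := Order.coheight_add_one_le hlt
          have h2 := h p ((mem_support_iff_of_equiv_quotient e).2 le_rfl)
          have h3 := h1.trans_lt h2
          rw [Nat.cast_add, Nat.cast_one] at h3
          exact lt_of_add_lt_add_right h3
        exact subsingleton_cechCohomology_succ_of_injective x hinj
    · intro N₁ _ _ _ N₂ _ _ _ N₃ _ _ _ f g hf hg hfg h1 h3 h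
      have h1' := h1 fun P hP => h P (Module.support_subset_of_injective f hf hP)
      have h3' := h3 fun P hP => h P (Module.support_subset_of_surjective g hg hP)
      refine subsingleton_of_forall_eq 0 fun c => ?_
      obtain ⟨b, rfl⟩ := (cechCohomologyMap_exact x hf hg hfg (i + 1) c).1 (Subsingleton.elim _ _)
      rw [Subsingleton.elim b 0, map_zero]

theorem isArtinian_cechCohomology (i : ℕ) :
    ∀ (N : Type v) [AddCommGroup N] [Module A N] [Module.Finite A N],
      (∀ P ∈ Module.support A N, (∀ j, x j ∈ P.asIdeal) → P.asIdeal.IsMaximal) →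
        IsArtinian A (CechCohomology x N i) := by
  induction i with
  | zero =>
    intro N _ _ hN
    refine IsNoetherianRing.induction_on_isQuotientEquivQuotientPrime A hN
      (motive := fun N _ _ _ => (∀ P ∈ Module.support A N, (∀ j, x j ∈ P.asIdeal) →
        P.asIdeal.IsMaximal) → IsArtinian A (CechCohomology x N 0)) ?_ ?_ ?_
    · intro N _ _ _ _ _
      have := subsingleton_cechCohomology_of_subsingleton x (M := N) 0
      infer_instance
    · intro N _ _ _ p e h
      by_cases hx : ∀ j, x j ∈ p.asIdeal
      · have hmax := h p ((mem_support_iff_of_equiv_quotient e).2 le_rfl) hx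
        have : IsSimpleModule A (A ⧸ p.asIdeal) := isSimpleModule_iff_isCoatom.2 hmax.out
        have : IsArtinian A N := isArtinian_of_linearEquiv e.symm
        exact isArtinian_cechCohomology_zero x
      · push Not at hx
        obtain ⟨j, hj⟩ := hx
        have := subsingleton_cechCohomology_zero_of_injective x
          (smul_id_injective_of_equiv_quotient e hj)
        infer_instance
    · intro N₁ _ _ _ N₂ _ _ _ N₃ _ _ _ f g hf hg hfg h1 h3 h
      have h1' := h1 fun P hP => h P (Module.support_subset_of_injective f hf hP)
      have h3' := h3 fun P hP => h P (Module.support_subset_of_surjective g hg hP)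
      exact isArtinian_of_range_eq_ker (cechCohomologyMap x f 0) (cechCohomologyMap x g 0)
        (cechCohomologyMap_exact x hf hg hfg 0).linearMap_ker_eq.symm
  | succ i ih =>
    intro N _ _ hN
    refine IsNoetherianRing.induction_on_isQuotientEquivQuotientPrime A hN
      (motive := fun N _ _ _ => (∀ P ∈ Module.support A N, (∀ j, x j ∈ P.asIdeal) →
        P.asIdeal.IsMaximal) → IsArtinian A (CechCohomology x N (i + 1))) ?_ ?_ ?_
    · intro N _ _ _ _ _
      have := subsingleton_cechCohomology_of_subsingleton x (M := N) (i + 1)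
      infer_instance
    · intro N _ _ _ p e h
      by_cases hx : ∀ j, x j ∈ p.asIdeal
      · have := subsingleton_cechTerm_succ_of_smul_eq_zero x (M := N)
          (fun j => smul_eq_zero_of_equiv_quotient e (hx j)) i
        have := subsingleton_cechCohomology_of_term x (M := N) (p := i + 1)
        infer_instance
      · push Not at hx
        obtain ⟨j, hj⟩ := hx
        have := ih (N ⧸ LinearMap.range (x j • LinearMap.id : N →ₗ[A] N)) fun P hP =>
          h P (mem_support_of_mem_support_quotient_smul (x j) hP).1
        exact isArtinian_cechCohomology_succ_of_injective x
          (smul_id_injective_of_equiv_quotient e hj)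
    · intro N₁ _ _ _ N₂ _ _ _ N₃ _ _ _ f g hf hg hfg h1 h3 h
      have h1' := h1 fun P hP => h P (Module.support_subset_of_injective f hf hP)
      have h3' := h3 fun P hP => h P (Module.support_subset_of_surjective g hg hP)
      exact isArtinian_of_range_eq_ker (cechCohomologyMap x f _) (cechCohomologyMap x g _)
        (cechCohomologyMap_exact x hf hg hfg _).linearMap_ker_eq.symm

end Noetherian

/-! ### Grothendieck nonvanishing for quotients by primes. -/

section Nonvanishing

variable {A : Type u} [CommRing A]

theorem mem_support_coker_prod {I J K : Ideal A} (hJ : I ≤ J) (hK : I ≤ K) {Q : PrimeSpectrum A}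
    (hQ : Q ∈ Module.support A (((A ⧸ J) × (A ⧸ K)) ⧸
      LinearMap.range ((Submodule.factor hJ).prod (Submodule.factor hK)))) :
    J ≤ Q.asIdeal ∧ K ≤ Q.asIdeal := by
  have hle := Module.annihilator_le_of_mem_support hQ
  constructor
  · refine le_trans (fun r hr => Module.mem_annihilator.2 fun c => ?_) hle
    obtain ⟨⟨a, b⟩, rfl⟩ := Submodule.mkQ_surjective _ c
    obtain ⟨a, rfl⟩ := Ideal.Quotient.mk_surjective a
    obtain ⟨b, rfl⟩ := Ideal.Quotient.mk_surjective b
    rw [← map_smul]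
    refine (Submodule.Quotient.mk_eq_zero _).2 ⟨Ideal.Quotient.mk I (r * b), Prod.ext ?_ rfl⟩
    exact Ideal.Quotient.eq.2 (J.sub_mem (J.mul_mem_right _ hr) (J.mul_mem_right _ hr))
  · refine le_trans (fun r hr => Module.mem_annihilator.2 fun c => ?_) hle
    obtain ⟨⟨a, b⟩, rfl⟩ := Submodule.mkQ_surjective _ c
    obtain ⟨a, rfl⟩ := Ideal.Quotient.mk_surjective a
    obtain ⟨b, rfl⟩ := Ideal.Quotient.mk_surjective b
    rw [← map_smul]
    refine (Submodule.Quotient.mk_eq_zero _).2 ⟨Ideal.Quotient.mk I (r * a), Prod.ext rfl ?_⟩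
    exact Ideal.Quotient.eq.2 (K.sub_mem (K.mul_mem_right _ hr) (K.mul_mem_right _ hr))

variable [IsNoetherianRing A] {l : ℕ} (x : Fin l → A)

/-- Prime avoidance gives `y ∈ Q₂` outside `P` and all members of `F`. A prime minimal over `P +
(y)` inside `Q₂` has height at most one modulo `P`, so it differs from `Q₂`, whose height modulo `P`
is at least two. -/
theorem exists_prime_between_notMem {P Q₁ Q₂ : PrimeSpectrum A} (h₁ : P < Q₁) (h₂ : Q₁ < Q₂)
    (F : Finset (PrimeSpectrum A)) (hF : ∀ Q ∈ F, ¬Q₂ ≤ Q) : ∃ Q, P < Q ∧ Q < Q₂ ∧ Q ∉ F := by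
  classical
  have hav : ¬((Q₂.asIdeal : Set A) ⊆
      ⋃ Q ∈ ((insert P F : Finset (PrimeSpectrum A)) : Set (PrimeSpectrum A)), Q.asIdeal) := by
    rw [Ideal.subset_union_prime P P fun Q _ _ _ => Q.isPrime]
    rintro ⟨Q, hQ, hle⟩
    rcases Finset.mem_insert.1 hQ with rfl | hQ
    · exact absurd (h₁.trans h₂) (not_lt_of_ge hle)
    · exact hF Q hQ hle
  obtain ⟨y, hy, hyn⟩ := Set.not_subset.1 hav
  have hyn' : ∀ Q ∈ insert P F, y ∉ Q.asIdeal := fun Q hQ hyQ =>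
    hyn (Set.mem_biUnion (by exact_mod_cast hQ) hyQ)
  have hle : P.asIdeal ⊔ Ideal.span {y} ≤ Q₂.asIdeal :=
    sup_le (h₁.trans h₂).le ((Ideal.span_singleton_le_iff_mem _).2 hy)
  obtain ⟨Q, hQ, hQle⟩ := Ideal.exists_minimalPrimes_le hle
  have hyQ : y ∈ Q := hQ.1.2 (Ideal.mem_sup_right (Ideal.mem_span_singleton_self y))
  refine ⟨⟨Q, hQ.1.1⟩, lt_of_le_of_ne (le_sup_left.trans hQ.1.2) ?_, lt_of_le_of_ne hQle ?_, ?_⟩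
  · intro he
    refine hyn' P (Finset.mem_insert_self _ _) ?_
    rw [he]
    exact hyQ
  · rintro rfl
    have h1 := Ideal.map_height_le_one_of_mem_minimalPrimes hQ
    have hprime : ∀ {Q : PrimeSpectrum A}, P ≤ Q →
        (Q.asIdeal.map (Ideal.Quotient.mk P.asIdeal)).IsPrime := fun {Q} h =>
      Ideal.isPrime_map_quotientMk_of_isPrime h
    have hlt : ∀ {Q Q' : PrimeSpectrum A}, P ≤ Q → Q < Q' →
        Q.asIdeal.map (Ideal.Quotient.mk P.asIdeal) <
          Q'.asIdeal.map (Ideal.Quotient.mk P.asIdeal) := by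
      intro Q Q' hPQ hQQ'
      refine lt_of_le_of_ne (Ideal.map_mono hQQ'.le) fun he => hQQ'.ne ?_
      have h3 := congrArg (Ideal.comap (Ideal.Quotient.mk P.asIdeal)) he
      rw [Ideal.comap_map_quotientMk, Ideal.comap_map_quotientMk, sup_eq_right.2 hPQ,
        sup_eq_right.2 (hPQ.trans hQQ'.le)] at h3
      exact PrimeSpectrum.ext h3
    have := hprime (h₁.trans h₂).le
    have := hprime h₁.le
    have := hprime (le_refl P)
    have h2 := (Ideal.height_le_iff (n := 1)).1 (by exact_mod_cast h1) _ (hprime h₁.le)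
      (hlt h₁.le h₂)
    have h3 : (Q₁.asIdeal.map (Ideal.Quotient.mk P.asIdeal)).height ≤ (0 : ℕ) := by
      simpa [Order.lt_one_iff] using h2
    have h4 := Ideal.height_le_iff.1 h3 _ (hprime (le_refl P)) (hlt le_rfl h₁)
    simp at h4
  · exact fun hQF => hyn' _ (Finset.mem_insert_of_mem hQF) hyQ

/-- The factors of a prime filtration of `N` are `A/P` itself or `A/p` with `p > P`, of dimension
less than `d`. -/
theorem subsingleton_cechCohomology_of_le_annihilator {P : PrimeSpectrum A} {d : ℕ}
    (hP : Order.coheight P ≤ d) (h0 : Subsingleton (CechCohomology x (A ⧸ P.asIdeal) d))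
    (N : Type v) [AddCommGroup N] [Module A N] [hN : Module.Finite A N]
    (h : P.asIdeal ≤ Module.annihilator A N) : Subsingleton (CechCohomology x N d) := by
  refine IsNoetherianRing.induction_on_isQuotientEquivQuotientPrime A hN
    (motive := fun N _ _ _ => P.asIdeal ≤ Module.annihilator A N →
      Subsingleton (CechCohomology x N d)) ?_ ?_ ?_ h
  · intro N _ _ _ _ _
    exact subsingleton_cechCohomology_of_subsingleton x _
  · intro N _ _ _ p e h
    rw [e.annihilator_eq, Ideal.annihilator_quotient] at h
    rcases eq_or_lt_of_le (show P ≤ p from h) with rfl | hlt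
    · exact subsingleton_cechCohomology_of_equiv x e d
    · refine subsingleton_cechCohomology_of_coheight_lt x d N fun Q hQ => ?_
      exact Order.coheight_le_coe_iff.1 hP Q
        (hlt.trans_le ((mem_support_iff_of_equiv_quotient e).1 hQ))
  · intro N₁ _ _ _ N₂ _ _ _ N₃ _ _ _ f g hf hg hfg h1 h3 h
    have h1' := h1 (h.trans (f.annihilator_le_of_injective hf))
    have h3' := h3 (h.trans (g.annihilator_le_of_surjective hg))
    refine subsingleton_of_forall_eq 0 fun c => ?_
    obtain ⟨b, rfl⟩ := (cechCohomologyMap_exact x hf hg hfg d c).1 (Subsingleton.elim _ _)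
    rw [Subsingleton.elim b 0, map_zero]

theorem surjective_of_cechCohomology_succ_subsingleton {P : PrimeSpectrum A} {d : ℕ}
    (hP : Order.coheight P ≤ (d + 1 : ℕ))
    (h0 : Subsingleton (CechCohomology x (A ⧸ P.asIdeal) (d + 1)))
    {N : Type u} [AddCommGroup N] [Module A N] [Module.Finite A N] (f : (A ⧸ P.asIdeal) →ₗ[A] N)
    (hN : ∀ Q ∈ Module.support A (N ⧸ LinearMap.range f), Order.coheight Q < d) :
    Function.Surjective (cechCohomologyMap x f d) := by
  have h1 : Subsingleton (CechCohomology x (LinearMap.ker f) (d + 1)) := by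
    refine subsingleton_cechCohomology_of_le_annihilator x hP h0 _ ?_
    refine le_trans ?_ ((LinearMap.ker f).subtype.annihilator_le_of_injective
      Subtype.val_injective)
    rw [Ideal.annihilator_quotient]
  have h2 := subsingleton_cechCohomology_of_coheight_lt x d (N ⧸ LinearMap.range f) hN
  exact cechCohomologyMap_surjective_of_ker_of_range x f d

/-- Suppose the group vanishes, and take a finite set `F` of primes of coheight `d` above `P` for
which the kernel of `H^d(A/P) → H^d(A/J_F)` is minimal, where `J_F` is the intersection of `F`. For
a new such prime `Q`, the map `A/P → A/J_F × A/Q` has cokernel of dimension less than `d`, so it is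
surjective on `H^d`. A preimage of `(0, g)` with `g ≠ 0` lies in the kernel for `F` but not in that
for `F ∪ {Q}`, contradicting minimality. -/
theorem not_subsingleton_cechCohomology_succ_of_infinite {P : PrimeSpectrum A} {d : ℕ}
    (hP : Order.coheight P = (d + 1 : ℕ)) [IsArtinian A (CechCohomology x (A ⧸ P.asIdeal) d)]
    (hnt : ∀ Q, P < Q → Order.coheight Q = d → Nontrivial (CechCohomology x (A ⧸ Q.asIdeal) d))
    (hinf : ∀ F : Finset (PrimeSpectrum A), (∀ Q ∈ F, Order.coheight Q = d) →
      ∃ Q, P < Q ∧ Order.coheight Q = d ∧ Q ∉ F) :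
    ¬Subsingleton (CechCohomology x (A ⧸ P.asIdeal) (d + 1)) := by
  classical
  intro h0
  let J : Finset (PrimeSpectrum A) → Ideal A := fun F => F.inf PrimeSpectrum.asIdeal
  let S : Set (Submodule A (CechCohomology x (A ⧸ P.asIdeal) d)) :=
    {K | ∃ (F : Finset (PrimeSpectrum A)) (_ : ∀ Q ∈ F, P < Q ∧ Order.coheight Q = d)
      (hJ : P.asIdeal ≤ J F), K = LinearMap.ker (cechCohomologyMap x (Submodule.factor hJ) d)}
  obtain ⟨K, ⟨F, hF, hJ, rfl⟩, hmin⟩ := IsArtinian.set_has_minimal S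
    ⟨_, ∅, by simp, by simp [J], rfl⟩
  obtain ⟨Q, hPQ, hQd, hQF⟩ := hinf F fun Q hQ => (hF Q hQ).2
  have hJ' : P.asIdeal ≤ J (insert Q F) := by
    simp only [J, Finset.inf_insert]
    exact le_inf hPQ.le hJ
  have hJF : J (insert Q F) ≤ J F := by
    simp only [J, Finset.inf_insert]
    exact inf_le_right
  have hJQ : J (insert Q F) ≤ Q.asIdeal := by
    simp only [J, Finset.inf_insert]
    exact inf_le_left
  have hPQ' : P.asIdeal ≤ Q.asIdeal := hPQ.le
  let φ := (Submodule.factor hJ).prod (Submodule.factor hPQ')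
  have hsurj : Function.Surjective (cechCohomologyMap x φ d) := by
    refine surjective_of_cechCohomology_succ_subsingleton x hP.le h0 φ fun Q' hQ' => ?_
    obtain ⟨h1, h2⟩ := mem_support_coker_prod hJ hPQ' hQ'
    obtain ⟨Q₀, hQ₀, hle⟩ := Q'.isPrime.inf_le'.1 h1
    have hlt : Q < Q' := by
      refine lt_of_le_of_ne h2 ?_
      rintro rfl
      rcases eq_or_lt_of_le (show Q₀ ≤ Q from hle) with rfl | hlt
      · exact hQF hQ₀
      · exact (Order.coheight_le_coe_iff.1 (hF Q₀ hQ₀).2.le Q hlt).ne hQd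
    exact Order.coheight_le_coe_iff.1 hQd.le Q' hlt
  have := hnt Q hPQ hQd
  obtain ⟨g, hg⟩ := exists_ne (0 : CechCohomology x (A ⧸ Q.asIdeal) d)
  obtain ⟨z, hz⟩ := hsurj (cechCohomologyMap x (LinearMap.inr A (A ⧸ J F) (A ⧸ Q.asIdeal)) d g)
  refine hmin _ ⟨insert Q F, fun Q' hQ' => ?_, hJ', rfl⟩ (lt_of_le_not_ge ?_ fun hle => ?_)
  · rcases Finset.mem_insert.1 hQ' with rfl | h
    · exact ⟨hPQ, hQd⟩
    · exact hF Q' h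
  · intro c hc
    have he : Submodule.factor hJ = (Submodule.factor hJF).comp (Submodule.factor hJ') := by
      ext; rfl
    rw [LinearMap.mem_ker] at hc ⊢
    rw [he, cechCohomologyMap_comp, hc, map_zero]
  · have h1 : z ∈ LinearMap.ker (cechCohomologyMap x (Submodule.factor hJ) d) := by
      rw [LinearMap.mem_ker, ← LinearMap.fst_prod (Submodule.factor hJ) (Submodule.factor hPQ'),
        cechCohomologyMap_comp, hz, ← cechCohomologyMap_comp, LinearMap.fst_comp_inr,
        cechCohomologyMap_zero]
    have h2 := LinearMap.mem_ker.1 (hle h1)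
    have h3 : cechCohomologyMap x (Submodule.factor hPQ') d z = g := by
      rw [← LinearMap.snd_prod (Submodule.factor hJ) (Submodule.factor hPQ'),
        cechCohomologyMap_comp, hz, ← cechCohomologyMap_comp, LinearMap.snd_comp_inr]
      conv_rhs => rw [← one_smul A g, ← cechCohomologyMap_smul_id, one_smul]
    have he : Submodule.factor hPQ' = (Submodule.factor hJQ).comp (Submodule.factor hJ') := by
      ext; rfl
    rw [he, cechCohomologyMap_comp, h2, map_zero] at h3
    exact hg h3.symm

theorem nontrivial_cechCohomology_quotient_prime [IsLocalRing A]
    (hx : ∀ j, x j ∈ IsLocalRing.maximalIdeal A) (d : ℕ) :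
    ∀ P : PrimeSpectrum A, (∀ Q, P ≤ Q → (∀ j, x j ∈ Q.asIdeal) → Q.asIdeal.IsMaximal) →
      Order.coheight P = d → Nontrivial (CechCohomology x (A ⧸ P.asIdeal) d) := by
  have hmax : ∀ P : PrimeSpectrum A, Order.coheight P = 0 → P = IsLocalRing.closedPoint A :=
    fun P hP => (Order.coheight_eq_zero.1 hP).eq_of_le
      (IsLocalRing.le_maximalIdeal P.isPrime.ne_top)
  have hsmul : ∀ (P : PrimeSpectrum A) (a : A), a ∈ P.asIdeal → ∀ m : A ⧸ P.asIdeal, a • m = 0 :=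
    fun P a ha => smul_eq_zero_of_equiv_quotient (LinearEquiv.refl A _) ha
  induction d with
  | zero =>
    intro P _ hP
    obtain rfl := hmax P hP
    exact nontrivial_cechCohomology_zero x fun j => hsmul _ _ (hx j)
  | succ d ih =>
    intro P hPx hP
    rw [← not_subsingleton_iff_nontrivial]
    have hP' : Order.coheight P = (d : ℕ∞) + 1 := by rw [hP]; simp
    obtain ⟨hfin, ⟨Q₁, hPQ₁, hQ₁⟩, hle⟩ := Order.coheight_eq_coe_add_one_iff.1 hP'
    have hnt : ∀ Q, P < Q → Order.coheight Q = d →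
        Nontrivial (CechCohomology x (A ⧸ Q.asIdeal) d) := fun Q hPQ hQ =>
      ih Q (fun Q' hQ' => hPx Q' (hPQ.le.trans hQ')) hQ
    -- Coheight one is separate, as no prime chain of length two is available to produce infinitely
    -- many primes. There `H^0(A/P) = 0` would have to surject onto the nonzero `H^0(A/Q₁)`.
    cases d with
    | zero =>
      intro h0
      have hex : ∃ j, x j ∉ P.asIdeal := by
        by_contra! hall
        have := hPx P le_rfl hall
        exact hPQ₁.ne (PrimeSpectrum.ext (this.eq_of_le Q₁.isPrime.ne_top hPQ₁.le))
      obtain ⟨j, hj⟩ := hex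
      have hPQ₁' : P.asIdeal ≤ Q₁.asIdeal := hPQ₁.le
      have h1 := subsingleton_cechCohomology_zero_of_injective x
        (smul_id_injective_of_equiv_quotient (LinearEquiv.refl A (A ⧸ P.asIdeal)) hj)
      have h2 := surjective_of_cechCohomology_succ_subsingleton x hP.le h0
        (Submodule.factor hPQ₁') fun Q hQ => by
          rw [LinearMap.range_eq_top.2 (Submodule.factor_surjective hPQ₁')] at hQ
          have : Subsingleton ((A ⧸ Q₁.asIdeal) ⧸ (⊤ : Submodule A (A ⧸ Q₁.asIdeal))) :=
            inferInstance
          rw [Module.support_eq_empty] at hQ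
          exact hQ.elim
      have h3 := hnt Q₁ hPQ₁ hQ₁
      exact not_subsingleton _ h2.subsingleton
    | succ e =>
      have hQ₁' : Order.coheight Q₁ = (e : ℕ∞) + 1 := by rw [hQ₁]; simp
      obtain ⟨-, ⟨Q₂, hQ₁₂, hQ₂⟩, -⟩ := Order.coheight_eq_coe_add_one_iff.1 hQ₁'
      have := isArtinian_cechCohomology x (e + 1) (A ⧸ P.asIdeal) fun Q hQ =>
        hPx Q ((mem_support_iff_of_equiv_quotient (LinearEquiv.refl A _)).1 hQ)
      refine not_subsingleton_cechCohomology_succ_of_infinite x hP hnt fun F hF => ?_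
      obtain ⟨Q, hPQ, hQQ₂, hQF⟩ := exists_prime_between_notMem hPQ₁ hQ₁₂ F fun Q hQ hle => by
        have h1 := Order.coheight_anti hle
        rw [hF Q hQ, hQ₂] at h1
        exact absurd (Nat.cast_le.1 h1) (by omega)
      refine ⟨Q, hPQ, le_antisymm (hle Q hPQ) ?_, hQF⟩
      have := Order.coheight_add_one_le hQQ₂
      rw [hQ₂] at this
      exact_mod_cast this

end Nonvanishing

open TensorProduct in
-- The fibre of `N` at `P` is a nonzero vector space, so it has a nonzero functional to the residue
-- field `Frac (A/P)`; finite generation allows its denominators to be cleared.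
theorem exists_hom_quotient_ne_zero {A : Type*} [CommRing A] {N : Type*} [AddCommGroup N]
    [Module A N] [Module.Finite A N] {P : PrimeSpectrum A} (hP : P ∈ Module.support A N) :
    ∃ f : N →ₗ[A] A ⧸ P.asIdeal, f ≠ 0 := by
  classical
  let K := P.asIdeal.ResidueField
  have hnt : Nontrivial (K ⊗[A] N) :=
    (Module.mem_support_iff_nontrivial_residueField_tensorProduct _).1 hP
  obtain ⟨t, ht⟩ := exists_ne (0 : K ⊗[A] N)
  obtain ⟨φ, hφ⟩ := Module.Projective.exists_dual_ne_zero K ht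
  let g : N →ₗ[A] K := (φ.restrictScalars A).comp (TensorProduct.mk A K N 1)
  have hg : ∃ n, g n ≠ 0 := by
    by_contra! h
    have h0 : ∀ z, φ z = 0 := fun z => by
      induction z with
      | zero => exact map_zero φ
      | tmul k n =>
        have h1 : k ⊗ₜ[A] n = k • ((1 : K) ⊗ₜ[A] n) := by simp [TensorProduct.smul_tmul']
        rw [h1, map_smul, show φ ((1 : K) ⊗ₜ[A] n) = 0 from h n, smul_zero]
      | add a b ha hb => rw [map_add, ha, hb, add_zero]
    exact hφ (h0 t)
  obtain ⟨s, hs⟩ := Module.Finite.fg_top (R := A) (M := N)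
  obtain ⟨⟨b, hb0⟩, hb⟩ := IsLocalization.exist_integer_multiples_of_finset
    (nonZeroDivisors (A ⧸ P.asIdeal)) (s.image g)
  obtain ⟨b, rfl⟩ := Ideal.Quotient.mk_surjective b
  let ψ : (A ⧸ P.asIdeal) →ₗ[A] K := (Algebra.linearMap (A ⧸ P.asIdeal) K).restrictScalars A
  have hψ : Function.Injective ψ := IsFractionRing.injective (A ⧸ P.asIdeal) K
  have hsmul : ∀ z : K, (Ideal.Quotient.mk P.asIdeal b) • z = b • z := fun z =>
    algebraMap_smul (A ⧸ P.asIdeal) b z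
  have hrange : ∀ n, b • g n ∈ LinearMap.range ψ := by
    intro n
    have hle : (⊤ : Submodule A N) ≤ (LinearMap.range ψ).comap (b • g) := by
      rw [← hs, Submodule.span_le]
      intro n hn
      obtain ⟨c, hc⟩ := hb _ (Finset.mem_image_of_mem g hn)
      exact ⟨c, hc.trans (hsmul _)⟩
    exact hle trivial
  refine ⟨(LinearEquiv.ofInjective ψ hψ).symm.toLinearMap.comp
    ((b • g).codRestrict (LinearMap.range ψ) hrange), fun h0 => ?_⟩
  obtain ⟨n, hn⟩ := hg
  have h1 := LinearMap.congr_fun h0 n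
  have h2 : b • g n = 0 := congrArg Subtype.val
    ((LinearEquiv.map_eq_zero_iff (LinearEquiv.ofInjective ψ hψ).symm).1 h1)
  rw [← hsmul, Algebra.smul_def] at h2
  rcases mul_eq_zero.1 h2 with h3 | h3
  · exact nonZeroDivisors.ne_zero hb0 (IsFractionRing.injective (A ⧸ P.asIdeal) K
      (h3.trans (map_zero _).symm))
  · exact hn h3

/-! ### Localization at a minimal prime of `Ann M + (x)`. -/

section LocalAtMinimal

variable {R : Type u} [CommRing R] {M : Type v} [AddCommGroup M] [Module R M]
  {l : ℕ} (x : Fin l → R) {q : Ideal R} [q.IsPrime]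

theorem maximalIdeal_le_of_mem_minimalPrimes
    (hq : q ∈ (Module.annihilator R M ⊔ Ideal.span (Set.range x)).minimalPrimes)
    {Q : Ideal (Localization.AtPrime q)} (hQ : Q.IsPrime)
    (hann : Module.annihilator (Localization.AtPrime q) (LocalizedModule q.primeCompl M) ≤ Q)
    (hx : ∀ j, algebraMap R _ (x j) ∈ Q) :
    IsLocalRing.maximalIdeal (Localization.AtPrime q) ≤ Q := by
  rw [← Localization.AtPrime.map_eq_maximalIdeal, Ideal.map_le_iff_le_comap]
  refine hq.2 ⟨hQ.comap _, sup_le (fun r hr => ?_) ?_⟩ ?_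
  · refine hann (Module.mem_annihilator.2 fun w => ?_)
    rw [algebraMap_smul]
    induction w using LocalizedModule.induction_on with
    | h m s => rw [LocalizedModule.smul'_mk, Module.mem_annihilator.1 hr, LocalizedModule.zero_mk]
  · rw [Ideal.span_le]
    rintro _ ⟨j, rfl⟩
    exact hx j
  · refine (Ideal.comap_mono (IsLocalRing.le_maximalIdeal hQ.ne_top)).trans_eq ?_
    exact Localization.AtPrime.under_maximalIdeal

/-- Krull's height theorem in `R_q / Ann(M_q)`: the maximal ideal is minimal over the images of the
`l` elements. -/
theorem supportDim_le_of_mem_minimalPrimes [IsNoetherianRing R] [Module.Finite R M]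
    (hq : q ∈ (Module.annihilator R M ⊔ Ideal.span (Set.range x)).minimalPrimes) :
    Module.supportDim (Localization.AtPrime q) (LocalizedModule q.primeCompl M) ≤
      (l : WithBot ℕ∞) := by
  rw [Module.supportDim_eq_ringKrullDim_quotient_annihilator]
  set I := Module.annihilator (Localization.AtPrime q) (LocalizedModule q.primeCompl M)
  rcases subsingleton_or_nontrivial (Localization.AtPrime q ⧸ I) with h | h
  · rw [ringKrullDim_eq_bot_of_subsingleton]
    exact bot_le
  · have : IsLocalRing (Localization.AtPrime q ⧸ I) :=
      IsLocalRing.of_surjective' (Ideal.Quotient.mk I) Ideal.Quotient.mk_surjective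
    have hIm : I ≤ IsLocalRing.maximalIdeal (Localization.AtPrime q) :=
      IsLocalRing.le_maximalIdeal (Ideal.Quotient.nontrivial_iff.1 h)
    rw [← IsLocalRing.maximalIdeal_height_eq_ringKrullDim]
    let y : Fin l → Localization.AtPrime q ⧸ I := fun j => Ideal.Quotient.mk I (algebraMap R _ (x j))
    have hmin : IsLocalRing.maximalIdeal (Localization.AtPrime q ⧸ I) ∈
        (Ideal.span (Set.range y)).minimalPrimes := by
      have hcomap : (IsLocalRing.maximalIdeal (Localization.AtPrime q ⧸ I)).comap
          (Ideal.Quotient.mk I) = IsLocalRing.maximalIdeal _ :=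
        IsLocalRing.eq_maximalIdeal
          (Ideal.comap_isMaximal_of_surjective _ Ideal.Quotient.mk_surjective)
      refine ⟨⟨inferInstance, Ideal.span_le.2 ?_⟩, ?_⟩
      · rintro _ ⟨j, rfl⟩
        change algebraMap R _ (x j) ∈ (IsLocalRing.maximalIdeal _).comap (Ideal.Quotient.mk I)
        rw [hcomap, IsLocalization.AtPrime.to_map_mem_maximal_iff _ q]
        exact hq.1.2 (Ideal.mem_sup_right (Ideal.subset_span ⟨j, rfl⟩))
      · rintro Q ⟨hQ, hxQ⟩ -
        have h1 := maximalIdeal_le_of_mem_minimalPrimes x hq (hQ.comap (Ideal.Quotient.mk I))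
          (fun r hr => by
            rw [Ideal.mem_comap, Ideal.Quotient.eq_zero_iff_mem.2 hr]
            exact zero_mem _) fun j => hxQ (Ideal.subset_span ⟨j, rfl⟩)
        rw [← hcomap] at h1
        exact (Ideal.comap_le_comap_iff_of_surjective _ Ideal.Quotient.mk_surjective _ _).1 h1
    have h2 := Ideal.height_le_card_of_mem_minimalPrimes_span (Set.finite_range y) hmin
    have h3 : (Set.range y).ncard ≤ l := by
      rw [← Set.image_univ]
      exact (Set.ncard_image_le Set.finite_univ).trans (by simp)
    exact_mod_cast h2.trans (Nat.cast_le.2 h3)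

/-- Supports are stable under specialization, so every chain starting at `P` stays in the support.
-/
theorem coheight_le_supportDim {A : Type*} [CommRing A] {N : Type*} [AddCommGroup N] [Module A N]
    {d : ℕ} (h : Module.supportDim A N ≤ d) {P : PrimeSpectrum A} (hP : P ∈ Module.support A N) :
    Order.coheight P ≤ d := by
  refine Order.coheight_le fun p hp => ?_
  let c : LTSeries (Module.support A N) :=
    { length := p.length
      toFun := fun i => ⟨p i, Module.mem_support_mono
        (show P ≤ p i from hp ▸ LTSeries.head_le p i) hP⟩
      step := fun i => p.step i }
  have h1 : ((p.length : ℕ) : WithBot ℕ∞) ≤ d :=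
    (show _ ≤ Module.supportDim A N from Order.le_krullDim_iff.2 ⟨c, rfl⟩).trans h
  exact_mod_cast h1

theorem exists_mem_support_coheight_eq {A : Type*} [CommRing A] {N : Type*} [AddCommGroup N]
    [Module A N] {d : ℕ} (h : Module.supportDim A N = d) :
    ∃ P ∈ Module.support A N, Order.coheight P = d := by
  obtain ⟨c, hc⟩ := Order.le_krullDim_iff.1 h.ge
  refine ⟨c.head.1, c.head.2, le_antisymm (coheight_le_supportDim h.le c.head.2) ?_⟩
  have := Order.length_le_coheight_head (p := c.map Subtype.val (fun _ _ h => h))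
  rw [← hc]
  exact this

/-- Take `P` in the support with coheight `d` and a nonzero `f : N → A/P`. Its kernel has dimension
at most `d` and its cokernel, a proper quotient of the domain `A/P`, has dimension less than `d`.
Hence `H^d(N)` surjects onto the nonzero `H^d(A/P)`. -/
theorem not_subsingleton_cechCohomology_of_supportDim_eq {A : Type u} [CommRing A]
    [IsNoetherianRing A] [IsLocalRing A] (y : Fin l → A)
    (hy : ∀ j, y j ∈ IsLocalRing.maximalIdeal A) {N : Type v} [AddCommGroup N] [Module A N]
    [Module.Finite A N]
    (hmax : ∀ Q ∈ Module.support A N, (∀ j, y j ∈ Q.asIdeal) → Q.asIdeal.IsMaximal) {d : ℕ}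
    (hd : Module.supportDim A N = d) : ¬Subsingleton (CechCohomology y N d) := by
  intro h0
  obtain ⟨P, hP, hPd⟩ := exists_mem_support_coheight_eq hd
  obtain ⟨f, hf⟩ := exists_hom_quotient_ne_zero hP
  have h1 : Subsingleton (CechCohomology y (LinearMap.ker f) (d + 1)) := by
    refine subsingleton_cechCohomology_of_coheight_lt y (d + 1) _ fun Q hQ => ?_
    have h2 := coheight_le_supportDim hd.le
      (Module.support_subset_of_injective (LinearMap.ker f).subtype Subtype.val_injective hQ)
    exact h2.trans_lt (by exact_mod_cast Nat.lt_succ_self d)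
  have h2 : Subsingleton (CechCohomology y ((A ⧸ P.asIdeal) ⧸ LinearMap.range f) d) := by
    refine subsingleton_cechCohomology_of_coheight_lt y d _ fun Q hQ => ?_
    have hann := Module.annihilator_le_of_mem_support hQ
    refine Order.coheight_le_coe_iff.1 hPd.le Q (lt_of_le_of_ne ?_ ?_)
    · refine le_trans (b := Module.annihilator A ((A ⧸ P.asIdeal) ⧸ LinearMap.range f)) ?_ hann
      refine le_trans ?_ ((Submodule.mkQ _).annihilator_le_of_surjective
        (Submodule.mkQ_surjective _))
      rw [Ideal.annihilator_quotient]
    · rintro rfl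
      obtain ⟨n, hn⟩ : ∃ n, f n ≠ 0 := by
        by_contra! h
        exact hf (LinearMap.ext h)
      obtain ⟨a, ha⟩ := Ideal.Quotient.mk_surjective (f n)
      have haP : a ∈ P.asIdeal := by
        refine hann (Module.mem_annihilator.2 fun c => ?_)
        obtain ⟨c, rfl⟩ := Submodule.mkQ_surjective _ c
        obtain ⟨b, rfl⟩ := Ideal.Quotient.mk_surjective c
        rw [← map_smul]
        refine (Submodule.Quotient.mk_eq_zero _).2 ⟨b • n, ?_⟩
        rw [map_smul, ← ha]
        exact congrArg (Ideal.Quotient.mk P.asIdeal) (mul_comm b a)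
      rw [← ha] at hn
      exact hn (Ideal.Quotient.eq_zero_iff_mem.2 haP)
  have h3 := cechCohomologyMap_surjective_of_ker_of_range y f d
  have h4 := nontrivial_cechCohomology_quotient_prime y hy d P
    (fun Q hQ => hmax Q (Module.mem_support_mono hQ hP)) hPd
  exact not_subsingleton _ h3.subsingleton

theorem nontrivial_localized_cechCohomology_top [IsNoetherianRing R] [Module.Finite R M]
    (hq : q ∈ (Module.annihilator R M ⊔ Ideal.span (Set.range x)).minimalPrimes)
    (hd : Module.supportDim (Localization.AtPrime q) (LocalizedModule q.primeCompl M) = l) :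
    Nontrivial (LocalizedModule q.primeCompl (CechCohomology x M l)) := by
  rw [← not_subsingleton_iff_nontrivial, subsingleton_localized_cechCohomology_top_iff]
  intro h
  let A := Localization.AtPrime q
  let y : Fin l → A := fun j => algebraMap R A (x j)
  refine not_subsingleton_cechCohomology_of_supportDim_eq y (fun j => ?_)
    (N := LocalizedModule q.primeCompl M) (fun Q hQ hyQ => ?_) hd ?_
  · rw [IsLocalization.AtPrime.to_map_mem_maximal_iff _ q]
    exact hq.1.2 (Ideal.mem_sup_right (Ideal.subset_span ⟨j, rfl⟩))
  · have h1 := maximalIdeal_le_of_mem_minimalPrimes x hq Q.isPrime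
      (Module.annihilator_le_of_mem_support hQ) hyQ
    rw [(IsLocalRing.le_maximalIdeal Q.isPrime.ne_top).antisymm h1]
    infer_instance
  -- The top-degree criterion over `R`, localized at `q`, is carried to the one for `M_q` over
  -- `R_q`, with no need to compare the two Čech complexes.
  · refine subsingleton_of_forall_eq 0 fun c => ?_
    obtain ⟨⟨c, hc⟩, rfl⟩ := cechClass_surjective y _ l c
    obtain ⟨n, w, rfl⟩ := exists_cechTop_eq y _ c
    rw [cechClass_eq_zero_iff, cechTop_mem_boundaries_iff]
    induction w using LocalizedModule.induction_on with
    | h m s =>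
      obtain ⟨u, hu, k, hk⟩ := h n m
      obtain ⟨m', hm'⟩ := (mem_span_range_smul_top_iff _ _).1 hk
      refine ⟨k, ?_⟩
      have hus : IsUnit (algebraMap R A (u * s)) :=
        IsLocalization.map_units A (⟨u, hu⟩ * s : q.primeCompl)
      rw [← Submodule.smul_mem_iff_of_isUnit _ hus, mem_span_range_smul_top_iff]
      refine ⟨fun i => LocalizedModule.mk (m' i) 1, ?_⟩
      have h1 : ∀ (r : R) (z : LocalizedModule q.primeCompl M), algebraMap R A r • z = r • z :=
        fun r z => algebraMap_smul A r z
      have h2 : (∏ i, y i) ^ k = algebraMap R A ((∏ i, x i) ^ k) := by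
        simp [y]
      have h3 : ∀ i, y i ^ (n + k) = algebraMap R A (x i ^ (n + k)) := fun i => by simp [y]
      simp only [h2, h3, h1, LocalizedModule.smul'_mk]
      have h4 : ∀ i, LocalizedModule.mk (x i ^ (n + k) • m' i) (1 : q.primeCompl) =
          LocalizedModule.mkLinearMap q.primeCompl M (x i ^ (n + k) • m' i) := fun i => rfl
      simp only [h4, ← map_sum, ← hm']
      rw [LocalizedModule.mkLinearMap_apply, mul_comm, mul_smul]
      rw [smul_comm u]
      exact LocalizedModule.mk_cancel s ((∏ i, x i) ^ k • u • m)

end LocalAtMinimal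

end ParamSeq

/-! ### The main theorem. -/

theorem mainTheorem6 {R : Type*} [CommRing R] {M : Type*} [AddCommGroup M] [Module R M]
    [Module.Finite R M] {l : ℕ} (x : Fin l → R) :
    (ParamSeq.IsParameterSequence x M →
      (l : WithBot ℕ∞) ≤ ParamSeq.heightOn M (Ideal.span (Set.range x))) ∧
    (IsNoetherianRing R →
      (ParamSeq.IsParameterSequence x M ↔
        ParamSeq.heightOn M (Ideal.span (Set.range x)) = (l : WithBot ℕ∞))) := by
  have part1 : ParamSeq.IsParameterSequence x M →
      (l : WithBot ℕ∞) ≤ ParamSeq.heightOn M (Ideal.span (Set.range x)) := by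
    intro h
    refine le_iInf₂ fun p hp => ?_
    by_contra! hlt
    have h1 := h.nontrivial_localization p (by rwa [Module.support_quotient])
    exact not_subsingleton _
      (ParamSeq.subsingleton_localized_cechCohomology_top_of_supportDim_lt x M p.asIdeal hlt)
  have hmin : ∀ p ∈ Module.support R M ∩ PrimeSpectrum.zeroLocus
      (Ideal.span (Set.range x) : Set R), ∃ q : PrimeSpectrum R, q ≤ p ∧ q ∈ Module.support R M ∩
        PrimeSpectrum.zeroLocus (Ideal.span (Set.range x) : Set R) ∧ q.asIdeal ∈
          (Module.annihilator R M ⊔ Ideal.span (Set.range x)).minimalPrimes := by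
    rintro p ⟨hp, hpx⟩
    obtain ⟨q, hq, hqp⟩ := Ideal.exists_minimalPrimes_le
      (sup_le (Module.annihilator_le_of_mem_support hp) hpx)
    exact ⟨⟨q, hq.1.1⟩, hqp, ⟨Module.mem_support_iff_of_finite.2 (le_sup_left.trans hq.1.2),
      le_sup_right.trans hq.1.2⟩, hq⟩
  refine ⟨part1, fun hR => ⟨fun h => le_antisymm ?_ (part1 h), fun h => ?_⟩⟩
  · have hnt := Submodule.Quotient.nontrivial_iff.2 h.smul_ne_top
    obtain ⟨p, hp⟩ := Module.nonempty_support_iff (R := R).2 hnt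
    rw [Module.support_quotient] at hp
    obtain ⟨q, -, hq, hqm⟩ := hmin p hp
    exact (iInf₂_le q hq).trans (ParamSeq.supportDim_le_of_mem_minimalPrimes x hqm)
  · have hle : ∀ p ∈ Module.support R M ∩ PrimeSpectrum.zeroLocus
        (Ideal.span (Set.range x) : Set R), (l : WithBot ℕ∞) ≤ ParamSeq.primeHeightOn M p :=
      fun p hp => h.ge.trans (iInf₂_le p hp)
    refine ⟨ParamSeq.isWeaklyProregular_of_isNoetherian x, fun htop => ?_, fun p hp => ?_⟩
    -- If `xM = M`, the infimum runs over the empty set and the height is `⊤`, which is not the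
    -- natural number `l`.
    · have hempty : Module.support R M ∩ PrimeSpectrum.zeroLocus
          (Ideal.span (Set.range x) : Set R) = ∅ := by
        rw [← Module.support_quotient, Module.support_eq_empty_iff,
          Submodule.Quotient.subsingleton_iff]
        exact htop
      rw [ParamSeq.heightOn, hempty] at h
      simp at h
      exact absurd h.symm (by exact WithBot.coe_injective.ne (ENat.natCast_ne_top l))
    · rw [Module.support_quotient] at hp
      obtain ⟨q, hqp, hq, hqm⟩ := hmin p hp
      have h1 := ParamSeq.nontrivial_localized_cechCohomology_top x hqm
        (le_antisymm (ParamSeq.supportDim_le_of_mem_minimalPrimes x hqm) (hle q hq))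
      -- If every class is killed by an element outside `p`, that element is also outside `q ⊆ p`,
      -- so the localization at `q` would vanish too.
      by_contra hs
      rw [not_nontrivial_iff_subsingleton, LocalizedModule.subsingleton_iff] at hs
      refine not_subsingleton (LocalizedModule q.asIdeal.primeCompl (ParamSeq.CechCohomology x M l))
        (LocalizedModule.subsingleton_iff.2 fun c => ?_)
      obtain ⟨r, hr, h0⟩ := hs c
      exact ⟨r, fun hrq => hr (hqp hrq), h0⟩
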